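/- Let $n\ge 1$. A permutation $w$ of $\mathbb Z$ is $2n$-periodic if $w(i+2n)=w(i)+2n$ for all $i$, and its total shift is $\frac1{2n}\sum_{x=1}^{2n}(w(x)-x)$. Let $W=W(\tilde A_{2n-1})$ be the group of $2n$-periodic permutations of $\mathbb Z$ of total shift $0$. Its reflections are the permutations $(a,b)$ with $a\not\equiv b \pmod{2n}$, which exchange $a+2nk$ and $b+2nk$ for all $k\in\mathbb Z$ and fix all other integers. Let $l(w)$ be the least number of factors in an expression of $w$ as a product of reflections, and say that $a$ divides $b$ in $W$ if $l(a)+l(a^{-1}b)=l(b)$. Let $X$ be the set of odd integers, $\Xi$ the set of even integers, and let $c\in W$ be the corresponding Coxeter element, $c(i)=i+2$ for $i\in X$ and $c(i)=i-2$ for $i\in\Xi$. A germ of monoid is a set with a partially defined product and a unit $1$ (that is, $1p$ and $p1$ are defined and equal to $p$ for all $p$). The dual germ $P$ is the set of elements of $W$ that divide $c$; for $a,b\in P$ the product is defined, and equal to $ab$, if $ab\in P$ and $l(ab)=l(a)+l(b)$. (The elements of $P$ are also known as the positive non-crossing $2n$-periodic permutations of total shift $0$ attached to $X$ and $\Xi$.)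 Conjugation by the involution $i\mapsto 1-i$ of $\mathbb Z$ stabilizes the set of reflections and fixes $c$, hence induces an automorphism $\sigma$ of the germ $P$. Let $P^\sigma=\{p\in P:\sigma(p)=p\}$, with the partial product of $P$. In a germ $Q$, $a$ left (resp. right) divides $b$ if $b=ac$ (resp. $b=ca$) for some $c\in Q$; $M(Q)$ is the monoid generated by $Q$ whose relations are the equalities of products in $Q$ (and the identification of the unit of $Q$ with $1$). The germ $Q$ is called a Garside germ if: - it is associative: if one of $a(bc)$, $(ab)c$ is defined, then so is the other and they are equal; - it is Noetherian: there is no infinite sequence $(p_i)_{i\ge0}$ in $Q$ such that, for every $i$, $p_{i+1}$ left divides $p_i$ and $p_{i+1}\ne p_i$, and none with the same property for right divisibility; - any two elements $a,b\in Q$ have a least common right multiple in $Q$, i.e. an element left divisible by $a$ and $b$ and left dividing every element that is left divisible by $a$ and $b$; - for all $m\in M(Q)$ and $a,b\in Q$, if $am=bm$ or $ma=mb$ in $M(Q)$, then $a=b$; - there is $\Delta\in Q$ that every element of $Q$ both left divides and right divides. **Theorem.** For every $n\ge1$, the germ $P^\sigma$ is a Garside germ. -/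

import Mathlib

/-! ## Germs of monoids -/

/-- A germ of monoid on the type `P`: a partially defined product with a unit. The product of
`a` and `b` is the partial value `mul a b : Part P`; thus `(mul a b).Dom` says that `ab` is
defined and `c ∈ mul a b` says that `ab` is defined and equal to `c`. -/
structure Germ (P : Type*) where
  mul : P → P → Part P
  one : P
  one_mul : ∀ p, mul one p = Part.some p
  mul_one : ∀ p, mul p one = Part.some p

namespace Germ

variable {P : Type*} (g : Germ P)

/-- If one of `a(bc)`, `(ab)c` is defined then so is the other, and they are equal
(this is exactly equality of the two partial values). -/
def IsAssociative : Prop :=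
  ∀ a b c : P, ((g.mul b c).bind fun x => g.mul a x) = ((g.mul a b).bind fun x => g.mul x c)

/-- `a` left divides `b`; in other words `b` is a right multiple of `a`. -/
def LeftDvd (a b : P) : Prop := ∃ c, b ∈ g.mul a c

/-- `a` right divides `b`; in other words `b` is a left multiple of `a`. -/
def RightDvd (a b : P) : Prop := ∃ c, b ∈ g.mul c a

/-- No infinite strictly decreasing sequence for left divisibility, nor for right divisibility.
Strict divisors of `b` are the divisors of `b` that are different from `b`, so that a Noetherian
germ has no invertible element other than the unit. -/
def IsNoetherian : Prop :=
  (¬ ∃ f : ℕ → P, ∀ i, g.LeftDvd (f (i + 1)) (f i) ∧ f (i + 1) ≠ f i) ∧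
  (¬ ∃ f : ℕ → P, ∀ i, g.RightDvd (f (i + 1)) (f i) ∧ f (i + 1) ≠ f i)

/-- The defining relations of the monoid of a germ. -/
inductive Rel : FreeMonoid P → FreeMonoid P → Prop
  | one : Rel (FreeMonoid.of g.one) 1
  | mul {a b c : P} (h : c ∈ g.mul a b) :
      Rel (FreeMonoid.of a * FreeMonoid.of b) (FreeMonoid.of c)

/-- The monoid `M(P)` generated by `P`, with the equalities of products in `P` as relations. -/
abbrev GermMonoid : Type _ := PresentedMonoid g.Rel

/-- The canonical map `P → M(P)`. -/
def toMonoid (p : P) : g.GermMonoid := PresentedMonoid.of g.Rel p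

/-- `m` is a least common right multiple of `a` and `b` in the germ. -/
def IsRightLcm (a b m : P) : Prop :=
  g.LeftDvd a m ∧ g.LeftDvd b m ∧ ∀ m', g.LeftDvd a m' → g.LeftDvd b m' → g.LeftDvd m m'

/-- Garside germs. -/
structure IsGarside : Prop where
  assoc : g.IsAssociative
  noeth : g.IsNoetherian
  exists_lcm : ∀ a b : P, ∃ m, g.IsRightLcm a b m
  cancel_right : ∀ (m : g.GermMonoid) (a b : P),
    g.toMonoid a * m = g.toMonoid b * m → a = b
  cancel_left : ∀ (m : g.GermMonoid) (a b : P),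
    m * g.toMonoid a = m * g.toMonoid b → a = b
  exists_delta : ∃ Δ : P, ∀ p, g.LeftDvd p Δ ∧ g.RightDvd p Δ

/-- An automorphism of a germ: a bijection preserving the unit such that `ab` is defined if and
only if `f(a)f(b)` is, in which case `f(ab) = f(a)f(b)`. -/
structure Aut extends P ≃ P where
  map_one' : toFun g.one = g.one
  map_mul' : ∀ a b, (g.mul a b).map toFun = g.mul (toFun a) (toFun b)

variable {g}

/-- The germ `P^σ` of fixed points of an automorphism, with the product of `P`. -/
def fixed (σ : g.Aut) : Germ {p : P // σ.toEquiv p = p} where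
  mul a b := ⟨(g.mul a b).Dom, fun h => ⟨(g.mul a b).get h, by
    have h1 : σ.toEquiv ((g.mul a b).get h) ∈ (g.mul a b).map σ.toEquiv :=
      Part.mem_map _ (Part.get_mem h)
    have h2 := σ.map_mul' a b
    change (g.mul a b).map σ.toEquiv = g.mul (σ.toEquiv a) (σ.toEquiv b) at h2
    rw [h2, a.2, b.2] at h1
    exact Part.mem_unique h1 (Part.get_mem h)⟩⟩
  one := ⟨g.one, σ.map_one'⟩
  one_mul p := by
    have h := g.one_mul p
    refine Part.ext' ?_ ?_
    · simp [h]
    · intro h1 h2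
      apply Subtype.ext
      simp [h]
  mul_one p := by
    have h := g.mul_one p
    refine Part.ext' ?_ ?_
    · simp [h]
    · intro h1 h2
      apply Subtype.ext
      simp [h]

end Germ

/-! ## The generated group method -/

section GeneratedGroup

variable {G : Type*} [Group G]

/-- Length of `x` with respect to the set `S` (which is meant to generate `G` as a monoid): the
length of a shortest expression of `x` as a product of elements of `S`. -/
noncomputable def wordLength (S : Set G) (x : G) : ℕ :=
  sInf {k | ∃ L : List G, (∀ s ∈ L, s ∈ S) ∧ L.prod = x ∧ L.length = k}

/-- `a` left divides `b` in `G` with respect to the length. -/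
def LenDvd (S : Set G) (a b : G) : Prop :=
  wordLength S a + wordLength S (a⁻¹ * b) = wordLength S b

theorem wordLength_one (S : Set G) : wordLength S 1 = 0 :=
  Nat.sInf_eq_zero.2 (Or.inl ⟨[], by simp⟩)

theorem wordLength_map (S : Set G) (φ : G ≃* G) (hS : ∀ s, φ s ∈ S ↔ s ∈ S) (x : G) :
    wordLength S (φ x) = wordLength S x := by
  unfold wordLength
  congr 1
  ext k
  constructor
  · rintro ⟨L, h1, h2, h3⟩
    refine ⟨L.map φ.symm, ?_, ?_, by simpa using h3⟩
    · intro s hs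
      obtain ⟨t, ht, rfl⟩ := List.mem_map.1 hs
      rw [← hS]
      simpa using h1 t ht
    · rw [← map_list_prod φ.symm, h2]
      simp
  · rintro ⟨L, h1, h2, h3⟩
    refine ⟨L.map φ, ?_, ?_, by simpa using h3⟩
    · intro s hs
      obtain ⟨t, ht, rfl⟩ := List.mem_map.1 hs
      exact (hS t).2 (h1 t ht)
    · rw [← map_list_prod φ, h2]

/-- The germ of divisors of `δ`: the product of `a` and `b` is defined, and equal to the product
`ab` in `G`, when `ab` divides `δ` and the lengths add up. -/
noncomputable def divisorGerm (S : Set G) (δ : G) : Germ {a : G // LenDvd S a δ} where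
  mul a b :=
    ⟨LenDvd S (a.1 * b.1) δ ∧ wordLength S (a.1 * b.1) = wordLength S a.1 + wordLength S b.1,
      fun h => ⟨a.1 * b.1, h.1⟩⟩
  one := ⟨1, by simp [LenDvd, wordLength_one]⟩
  one_mul p := by
    refine Part.ext' ?_ ?_
    · simp [wordLength_one, p.2]
    · intro h1 h2
      apply Subtype.ext
      simp
  mul_one p := by
    refine Part.ext' ?_ ?_
    · simp [wordLength_one, p.2]
    · intro h1 h2
      apply Subtype.ext
      simp

theorem lenDvd_map (S : Set G) (δ : G) (φ : G ≃* G) (hS : ∀ s, φ s ∈ S ↔ s ∈ S)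
    (hδ : φ δ = δ) (a : G) : LenDvd S (φ a) δ ↔ LenDvd S a δ := by
  have h : (φ a)⁻¹ * δ = φ (a⁻¹ * δ) := by simp [hδ]
  unfold LenDvd
  rw [h, wordLength_map S φ hS, wordLength_map S φ hS]

/-- The automorphism of the germ of divisors of `δ` induced by an automorphism of the group that
stabilizes `S` and fixes `δ`. -/
noncomputable def divisorGermAut (S : Set G) (δ : G) (φ : G ≃* G) (hS : ∀ s, φ s ∈ S ↔ s ∈ S)
    (hδ : φ δ = δ) : (divisorGerm S δ).Aut where
  toEquiv := φ.toEquiv.subtypeEquiv fun a => (lenDvd_map S δ φ hS hδ a).symm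
  map_one' := by
    apply Subtype.ext
    simp [divisorGerm]
  map_mul' a b := by
    refine Part.ext' ?_ ?_
    · have h : φ a.1 * φ b.1 = φ (a.1 * b.1) := by simp
      simp only [divisorGerm, Part.map_Dom, Equiv.toFun_as_coe, Equiv.subtypeEquiv_apply,
        MulEquiv.toEquiv_eq_coe, MulEquiv.coe_toEquiv]
      rw [h, lenDvd_map S δ φ hS hδ, wordLength_map S φ hS, wordLength_map S φ hS,
        wordLength_map S φ hS]
    · intro h1 h2
      apply Subtype.ext
      exact map_mul φ a.1 b.1

end GeneratedGroup

/-! ## The Coxeter group of type `Ã` and the dual germ -/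

/-- `w` is an `N`-periodic permutation of `ℤ`. -/
def IsPeriodic (N : ℕ) (w : Equiv.Perm ℤ) : Prop := ∀ i, w (i + N) = w i + N

/-- The total shift of a periodic permutation. -/
noncomputable def totalShift (N : ℕ) (w : Equiv.Perm ℤ) : ℚ :=
  (1 / N : ℚ) * ∑ x ∈ Finset.Icc (1 : ℤ) N, ((w x - x : ℤ) : ℚ)

theorem IsPeriodic.add_mul {N : ℕ} {w : Equiv.Perm ℤ} (h : IsPeriodic N w) (i k : ℤ) :
    w (i + k * N) = w i + k * N := by
  induction k using Int.induction_on with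
  | zero => simp
  | succ k ih =>
    have := h (i + k * N)
    rw [ih] at this
    rw [show i + ((k : ℤ) + 1) * N = i + k * N + N by ring, this]
    ring
  | pred k ih =>
    have := h (i + (-(k : ℤ) - 1) * N)
    rw [show i + (-(k : ℤ) - 1) * N + N = i + -(k : ℤ) * N by ring, ih] at this
    linarith

theorem IsPeriodic.mul {N : ℕ} {w v : Equiv.Perm ℤ} (hw : IsPeriodic N w) (hv : IsPeriodic N v) :
    IsPeriodic N (w * v) := fun i => by
  simp only [Equiv.Perm.mul_apply, hv i, hw (v i)]

theorem IsPeriodic.inv {N : ℕ} {w : Equiv.Perm ℤ} (hw : IsPeriodic N w) :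
    IsPeriodic N w⁻¹ := fun i => by
  apply w.injective
  rw [hw]
  simp

/-- Reindexing the sum of an `N`-periodic function over a period by a periodic permutation. -/
theorem sum_period {N : ℕ} {v : Equiv.Perm ℤ} (hv : IsPeriodic N v) (f : ℤ → ℚ)
    (hf : ∀ i k : ℤ, f (i + k * N) = f i) :
    ∑ x ∈ Finset.Icc (1 : ℤ) N, f (v x) = ∑ x ∈ Finset.Icc (1 : ℤ) N, f x := by
  rcases Nat.eq_zero_or_pos N with rfl | hN
  · simp
  have hN' : (0 : ℤ) < N := by exact_mod_cast hN
  have key : ∀ (u : Equiv.Perm ℤ), IsPeriodic N u → ∀ x ∈ Finset.Icc (1 : ℤ) N,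
      (u⁻¹ ((u x - 1) % N + 1) - 1) % N + 1 = x := by
    intro u hu x hx
    rw [Finset.mem_Icc] at hx
    have e : (u x - 1) % N + 1 = u x + (-((u x - 1) / N)) * N := by
      have := Int.emod_add_mul_ediv (u x - 1) N
      linarith
    rw [e, hu.inv.add_mul]
    rw [Equiv.Perm.inv_def, Equiv.symm_apply_apply]
    rw [show x + -((u x - 1) / N) * N - 1 = x - 1 + (N : ℤ) * (-((u x - 1) / N)) by ring,
      Int.add_mul_emod_self_left, Int.emod_eq_of_lt (by linarith) (by linarith)]
    ring
  have rng : ∀ y : ℤ, (y - 1) % N + 1 ∈ Finset.Icc (1 : ℤ) N := by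
    intro y
    have h1 := Int.emod_nonneg (y - 1) hN'.ne'
    have h2 := Int.emod_lt_of_pos (y - 1) hN'
    rw [Finset.mem_Icc]
    constructor <;> linarith
  refine Finset.sum_bij' (fun x _ => (v x - 1) % N + 1) (fun x _ => (v⁻¹ x - 1) % N + 1)
    (fun x _ => rng _) (fun x _ => rng _) (fun x hx => key v hv x hx) (fun x hx => ?_)
    (fun x _ => ?_)
  · simpa using key v⁻¹ hv.inv x hx
  · have e : (v x - 1) % N + 1 = v x + (-((v x - 1) / N)) * N := by
      have := Int.emod_add_mul_ediv (v x - 1) N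
      linarith
    rw [e, hf]

theorem totalShift_mul {N : ℕ} {w v : Equiv.Perm ℤ} (hw : IsPeriodic N w) (hv : IsPeriodic N v) :
    totalShift N (w * v) = totalShift N w + totalShift N v := by
  unfold totalShift
  rw [← mul_add, ← sum_period hv (fun x => ((w x - x : ℤ) : ℚ)), ← Finset.sum_add_distrib]
  · congr 1
    refine Finset.sum_congr rfl fun x _ => ?_
    push_cast
    simp
  · intro i k
    rw [hw.add_mul]
    congr 1
    ring

/-- The Coxeter group of type `Ã_{N-1}`: the `N`-periodic permutations of `ℤ` of total shift
zero. -/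
noncomputable def WA (N : ℕ) : Subgroup (Equiv.Perm ℤ) where
  carrier := {w | IsPeriodic N w ∧ totalShift N w = 0}
  mul_mem' := fun {a b} ha hb =>
    ⟨ha.1.mul hb.1, by rw [totalShift_mul ha.1 hb.1, ha.2, hb.2, add_zero]⟩
  one_mem' := ⟨fun i => by simp, by simp [totalShift]⟩
  inv_mem' := fun {a} ha => ⟨ha.1.inv, by
    have h := totalShift_mul ha.1 ha.1.inv
    rw [ha.2, zero_add, mul_inv_cancel] at h
    rw [← h]
    simp [totalShift]⟩

/-- `w` is the `N`-periodic permutation `(a, b)`: it exchanges `a + kN` and `b + kN` for all `k`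
and fixes all other integers. -/
def IsTransposition (N : ℕ) (a b : ℤ) (w : Equiv.Perm ℤ) : Prop :=
  (∀ k : ℤ, w (a + k * N) = b + k * N ∧ w (b + k * N) = a + k * N) ∧
  ∀ x : ℤ, ¬ x ≡ a [ZMOD N] → ¬ x ≡ b [ZMOD N] → w x = x

/-- The reflections of the Coxeter group of type `Ã_{N-1}`. -/
def reflections (N : ℕ) : Set (WA N) :=
  {w | ∃ a b : ℤ, ¬ a ≡ b [ZMOD N] ∧ IsTransposition N a b w.1}

/-- The permutation `i ↦ i + 2` for odd `i`, `i ↦ i - 2` for even `i`. -/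
def cPerm : Equiv.Perm ℤ where
  toFun i := if Odd i then i + 2 else i - 2
  invFun i := if Odd i then i - 2 else i + 2
  left_inv i := by
    by_cases h : Odd i
    · have h2 : Odd (i + 2) := by grind
      simp [h, h2]
    · have h2 : ¬ Odd (i - 2) := by grind
      simp only [h, h2, if_false]
      ring
  right_inv i := by
    by_cases h : Odd i
    · have h2 : Odd (i - 2) := by grind
      simp [h, h2]
    · have h2 : ¬ Odd (i + 2) := by grind
      simp only [h, h2, if_false]
      ring

theorem cPerm_mem (n : ℕ) : cPerm ∈ WA (2 * n) := by
  constructor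
  · intro i
    have h : Odd (i + ((2 * n : ℕ) : ℤ)) ↔ Odd i := by
      push_cast
      constructor <;> intro h <;> grind
    simp only [cPerm, Equiv.coe_fn_mk, h]
    split_ifs <;> ring
  · have h : ∑ x ∈ Finset.Icc (1 : ℤ) ((2 * n : ℕ) : ℤ), ((cPerm x - x : ℤ) : ℚ) = 0 := by
      induction n with
      | zero => simp
      | succ n ih =>
        have e : Finset.Icc (1 : ℤ) ((2 * (n + 1) : ℕ) : ℤ) =
            insert ((2 * n + 1 : ℤ)) (insert ((2 * n + 2 : ℤ))
              (Finset.Icc (1 : ℤ) ((2 * n : ℕ) : ℤ))) := by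
          ext x
          simp only [Finset.mem_Icc, Finset.mem_insert]
          push_cast
          omega
        have o1 : Odd (2 * n + 1 : ℤ) := by grind
        have o2 : ¬ Odd (2 * n + 2 : ℤ) := by grind
        rw [e, Finset.sum_insert (by simp), Finset.sum_insert (by simp), ih]
        simp [cPerm, o1, o2]
    unfold totalShift
    rw [h, mul_zero]

/-- The Coxeter element `c` of `W(Ã_{2n-1})` attached to `X` = odd integers, `Ξ` = even
integers: it sends each element of `X` to the next one and each element of `Ξ` to the previous
one. -/
noncomputable def coxeterC (n : ℕ) : WA (2 * n) := ⟨cPerm, cPerm_mem n⟩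

/-- The dual germ `P` of type `Ã_{2n-1}` attached to `X` = odd integers, `Ξ` = even integers:
the divisors of `c` for the reflection length. -/
noncomputable def dualGerm (n : ℕ) : Germ {w : WA (2 * n) // LenDvd (reflections (2 * n)) w (coxeterC n)} :=
  divisorGerm (reflections (2 * n)) (coxeterC n)

/-! ## The involution `σ` -/

/-- The involution `i ↦ 1 - i` of `ℤ`. -/
def oneSub : Equiv.Perm ℤ where
  toFun i := 1 - i
  invFun i := 1 - i
  left_inv i := by ring
  right_inv i := by ring

theorem oneSub_conj_apply (w : Equiv.Perm ℤ) (i : ℤ) : (oneSub * w * oneSub) i = 1 - w (1 - i) := rfl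

theorem oneSub_conj_mem {N : ℕ} {w : Equiv.Perm ℤ} (hw : w ∈ WA N) : oneSub * w * oneSub ∈ WA N := by
  obtain ⟨h1, h2⟩ := hw
  refine ⟨fun i => ?_, ?_⟩
  · have := h1 (1 - (i + N))
    rw [show 1 - (i + N) + N = 1 - i by ring] at this
    rw [oneSub_conj_apply, oneSub_conj_apply, this]
    ring
  · have e : totalShift N (oneSub * w * oneSub) = - totalShift N w := by
      unfold totalShift
      rw [← mul_neg, ← Finset.sum_neg_distrib]
      congr 1
      refine Finset.sum_bij' (fun x _ => N + 1 - x) (fun x _ => N + 1 - x) ?_ ?_ ?_ ?_ ?_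
      · intro x hx
        simp only [Finset.mem_Icc] at hx ⊢
        omega
      · intro x hx
        simp only [Finset.mem_Icc] at hx ⊢
        omega
      · intro x _
        ring
      · intro x _
        ring
      · intro x _
        have := h1 (1 - x)
        rw [oneSub_conj_apply, show (N : ℤ) + 1 - x = 1 - x + N by ring, this]
        push_cast
        ring
    rw [e, h2, neg_zero]

/-- The involution `w ↦ σ w σ⁻¹` of `W(Ã_{N-1})` given by `σ : i ↦ 1 - i`. -/
noncomputable def sigmaW (N : ℕ) : WA N ≃* WA N where
  toFun w := ⟨oneSub * w.1 * oneSub, oneSub_conj_mem w.2⟩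
  invFun w := ⟨oneSub * w.1 * oneSub, oneSub_conj_mem w.2⟩
  left_inv w := by
    apply Subtype.ext
    ext i
    simp [oneSub]
  right_inv w := by
    apply Subtype.ext
    ext i
    simp [oneSub]
  map_mul' v w := by
    apply Subtype.ext
    ext i
    simp [oneSub]

theorem sigmaW_sigmaW (N : ℕ) (w : WA N) : sigmaW N (sigmaW N w) = w := (sigmaW N).left_inv w

theorem sigmaW_reflection {N : ℕ} {w : WA N} (h : w ∈ reflections N) :
    sigmaW N w ∈ reflections N := by
  obtain ⟨a, b, hab, h1, h2⟩ := h
  have hm : ∀ x y : ℤ, 1 - x ≡ y [ZMOD N] → x ≡ 1 - y [ZMOD N] := by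
    intro x y h
    have := (Int.ModEq.refl (n := (N : ℤ)) 1).sub h
    simpa using this
  refine ⟨1 - a, 1 - b, fun h => hab ?_, fun k => ⟨?_, ?_⟩, fun x hxa hxb => ?_⟩
  · simpa using hm _ _ h
  · change 1 - w.1 (1 - (1 - a + k * N)) = _
    rw [show 1 - (1 - a + k * N) = a + (-k) * N by ring, (h1 (-k)).1]
    ring
  · change 1 - w.1 (1 - (1 - b + k * N)) = _
    rw [show 1 - (1 - b + k * N) = b + (-k) * N by ring, (h1 (-k)).2]
    ring
  · change 1 - w.1 (1 - x) = x
    rw [h2 (1 - x) (fun h => hxa (hm _ _ h)) (fun h => hxb (hm _ _ h))]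
    ring

theorem sigmaW_reflection_iff (N : ℕ) (w : WA N) :
    sigmaW N w ∈ reflections N ↔ w ∈ reflections N :=
  ⟨fun h => by simpa [sigmaW_sigmaW] using sigmaW_reflection h, sigmaW_reflection⟩

theorem sigmaW_coxeterC (n : ℕ) : sigmaW (2 * n) (coxeterC n) = coxeterC n := by
  apply Subtype.ext
  ext i
  change 1 - cPerm (1 - i) = cPerm i
  simp only [cPerm, Equiv.coe_fn_mk]
  by_cases h : Odd i
  · have h2 : ¬ Odd (1 - i) := by grind
    simp only [h, h2, if_true, if_false]
    ring
  · have h2 : Odd (1 - i) := by grind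
    simp only [h, h2, if_true, if_false]
    ring

/-- The automorphism `σ` of the germ `P` coming from `i ↦ 1 - i`. -/
noncomputable def sigma (n : ℕ) : (dualGerm n).Aut :=
  divisorGermAut (reflections (2 * n)) (coxeterC n) (sigmaW (2 * n))
    (sigmaW_reflection_iff (2 * n)) (sigmaW_coxeterC n)

/-! The group acts by composition on the functions with `f (x + N) = 2 * f x`, a rational space of
dimension `N = 2n`. An invariant function is constant on orbits, and vanishes on an orbit containing
two distinct translates of a point, because a nontrivial power of 2 is never 1. So `invDim w` counts
the finite orbits up to translation, and `2n - invDim w` is a codimension which is subadditive and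
at most 1 on reflections. It bounds the reflection length from below on products of reflections, and
equals it on divisors of `c`. These are the `w` for which the codimensions of `w` and `w⁻¹ c` add up
to that of `c`, which is `2n` (`IsDual`, `lenDvd_coxeterC_iff`).

This additivity becomes combinatorial in the order where the odd integers increase and are followed
by the decreasing even integers: `c` sends each point to its immediate successor. Every finite orbit
has a weak descent, so `invDim w` is at most the number of descents, and the descents of `w` and
`w⁻¹ c` number `2n` in total. Hence `w` divides `c` exactly when, in both permutations, finite
orbits have one descent and infinite ones none (`isDual_iff`). It follows that `w` runs cyclically
through non-crossing classes, all infinite orbits being put in one class. Conversely a symmetric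
non-crossing partition of this kind defines, by cyclic succession, a divisor of `c` fixed by `σ`;
symmetry is what forces total shift zero.

For elements fixed by `σ`, divisibility is reverse inclusion of the spaces of invariants
(`leftDvd_fixed_iff`). The key is the form `∑ f(x) g(1 - x)`, preserved by these elements: it makes
the range of `w - 1` the orthogonal of the invariants of `w`, so that passing to `w⁻¹ c` reverses
inclusions.

The admissible partitions are stable under arbitrary intersection, so intersecting those of all
common multiples of two elements gives the least one. Cancellation holds because the monoid maps to
the group, injectively on the germ; `Δ` is `c`; Noetherianity and associativity follow from the
dimension count. -/

open Module

/-! ## Twisted functions on `ℤ` -/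

/-- The functions on `ℤ` which are doubled by the translation by `N`. -/
def Twisted (N : ℕ) : Submodule ℚ (ℤ → ℚ) where
  carrier := {f | ∀ x, f (x + N) = 2 * f x}
  add_mem' {f g} hf hg x := by simp [hf x, hg x, mul_add]
  zero_mem' x := by simp
  smul_mem' a f hf x := by simp [hf x, mul_left_comm]

theorem twisted_apply_add_mul {N : ℕ} (f : Twisted N) (x j : ℤ) :
    f.1 (x + j * N) = 2 ^ j * f.1 x := by
  induction j using Int.induction_on with
  | zero => simp
  | succ k ih =>
    have := f.2 (x + k * N)
    rw [show x + ((k : ℤ) + 1) * N = x + k * N + N by ring, this, ih,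
      zpow_add₀ (by norm_num : (2 : ℚ) ≠ 0)]
    ring
  | pred k ih =>
    have := f.2 (x + (-(k : ℤ) - 1) * N)
    rw [show x + (-(k : ℤ) - 1) * N + N = x + -(k : ℤ) * N by ring, ih] at this
    rw [zpow_sub₀ (by norm_num : (2 : ℚ) ≠ 0)]
    linarith

theorem two_zpow_eq_one {j : ℤ} (h : (2 : ℚ) ^ j = 1) : j = 0 := by
  rcases zpow_eq_one_iff_cases₀.1 h with h | h | h
  · exact h
  · norm_num at h
  · norm_num at h

/-- The extension to `ℤ` of a function on `{0, …, N - 1}`. -/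
def twistedEquiv (N : ℕ) [NeZero N] : Twisted N ≃ₗ[ℚ] (Fin N → ℚ) where
  toFun f i := f.1 (i : ℕ)
  map_add' _ _ := rfl
  map_smul' _ _ := rfl
  invFun g := ⟨fun x => 2 ^ (x / (N : ℤ)) * g ⟨(x % N).toNat, by
      have h1 := Int.emod_nonneg x (Int.natCast_ne_zero.2 (NeZero.ne N))
      have h2 := Int.emod_lt_of_pos x (Int.natCast_pos.2 (NeZero.pos N))
      omega⟩, fun x => by
    have h0 : (N : ℤ) ≠ 0 := Int.natCast_ne_zero.2 (NeZero.ne N)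
    simp only [Int.add_ediv_of_dvd_right (dvd_refl (N : ℤ)), Int.ediv_self h0, Int.add_emod_right]
    rw [zpow_add₀ (by norm_num : (2 : ℚ) ≠ 0)]
    ring⟩
  left_inv f := by
    apply Subtype.ext
    funext x
    have h1 := Int.emod_nonneg x (Int.natCast_ne_zero.2 (NeZero.ne N))
    simp only
    rw [Int.toNat_of_nonneg h1, ← twisted_apply_add_mul]
    have := Int.emod_add_mul_ediv x N
    rw [mul_comm] at this
    exact congrArg f.1 this
  right_inv g := by
    funext i
    have h2 : ((i : ℕ) : ℤ) < N := by exact_mod_cast i.2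
    have h1 : (0 : ℤ) ≤ ((i : ℕ) : ℤ) := by positivity
    simp only [Int.ediv_eq_zero_of_lt h1 h2, Int.emod_eq_of_lt h1 h2, Int.toNat_natCast]
    simp

instance (N : ℕ) [NeZero N] : FiniteDimensional ℚ (Twisted N) :=
  Module.Finite.equiv (twistedEquiv N).symm

theorem finrank_twisted (N : ℕ) [NeZero N] : finrank ℚ (Twisted N) = N := by
  rw [(twistedEquiv N).finrank_eq]
  simp

/-- The twisted function supported by the class of `a` which takes the value `1` at `a`. -/
def twistedSingle (N : ℕ) [NeZero N] (a : ℤ) : Twisted N :=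
  ⟨fun x => if (N : ℤ) ∣ x - a then 2 ^ ((x - a) / (N : ℤ)) else 0, fun x => by
    have h0 : (N : ℤ) ≠ 0 := Int.natCast_ne_zero.2 (NeZero.ne N)
    have e : x + N - a = x - a + N := by ring
    simp only [e, dvd_add_self_right]
    split_ifs with h
    · rw [Int.add_ediv_of_dvd_left h, Int.ediv_self h0, zpow_add₀ (by norm_num : (2 : ℚ) ≠ 0)]
      ring
    · simp⟩

theorem twistedSingle_add_mul (N : ℕ) [NeZero N] (a j : ℤ) :
    (twistedSingle N a).1 (a + j * N) = 2 ^ j := by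
  have h0 : (N : ℤ) ≠ 0 := Int.natCast_ne_zero.2 (NeZero.ne N)
  simp [twistedSingle, Int.mul_ediv_cancel _ h0]

theorem twistedSingle_self (N : ℕ) [NeZero N] (a : ℤ) : (twistedSingle N a).1 a = 1 := by
  simpa using twistedSingle_add_mul N a 0

theorem twistedSingle_of_not_modEq {N : ℕ} [NeZero N] {a x : ℤ} (h : ¬ x ≡ a [ZMOD N]) :
    (twistedSingle N a).1 x = 0 := by
  have : ¬ (N : ℤ) ∣ x - a := fun h' => h (Int.modEq_iff_dvd.2 h').symm
  simp [twistedSingle, this]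

theorem Int.ModEq.exists_eq_add_mul {N : ℕ} {a x : ℤ} (h : x ≡ a [ZMOD N]) :
    ∃ j : ℤ, x = a + j * N := by
  obtain ⟨j, hj⟩ := Int.modEq_iff_dvd.1 h.symm
  exact ⟨j, by linarith⟩

theorem Int.add_mul_modEq (N : ℕ) (a j : ℤ) : a + j * N ≡ a [ZMOD N] := by
  simp [Int.ModEq]

/-! ## Invariant twisted functions and codimension -/

/-- The action of periodic permutations on twisted functions, by composition. -/
def pullback {N : ℕ} (w : WA N) : Twisted N →ₗ[ℚ] Twisted N where
  toFun f := ⟨fun x => f.1 (w.1 x), fun x => by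
    have h : w.1 (x + N) = w.1 x + N := w.2.1 x
    simp only [h]
    exact f.2 _⟩
  map_add' _ _ := rfl
  map_smul' _ _ := rfl

/-- The twisted functions which are invariant by `w`. -/
def invariants {N : ℕ} (w : WA N) : Submodule ℚ (Twisted N) :=
  LinearMap.ker (pullback w - 1)

theorem mem_invariants {N : ℕ} {w : WA N} {f : Twisted N} :
    f ∈ invariants w ↔ ∀ x, f.1 (w.1 x) = f.1 x := by
  simp only [invariants, LinearMap.mem_ker, LinearMap.sub_apply, Module.End.one_apply, sub_eq_zero]
  constructor
  · intro h x
    exact congrFun (congrArg Subtype.val h) x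
  · intro h
    exact Subtype.ext (funext h)

/-- The dimension of the space of invariant twisted functions. -/
noncomputable def invDim {N : ℕ} (w : WA N) : ℕ := finrank ℚ (invariants w)

theorem invariants_one (N : ℕ) : invariants (1 : WA N) = ⊤ := by
  ext f
  simp [mem_invariants]

theorem inf_invariants_le {N : ℕ} (u v : WA N) :
    invariants u ⊓ invariants v ≤ invariants (u * v) := by
  rintro f ⟨hu, hv⟩
  have hu := mem_invariants.1 hu
  have hv := mem_invariants.1 hv
  refine mem_invariants.2 fun x => ?_
  change f.1 (u.1 (v.1 x)) = _
  rw [hu, hv]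

theorem invariants_inv {N : ℕ} (u : WA N) : invariants u⁻¹ = invariants u := by
  ext f
  simp only [mem_invariants]
  constructor
  · intro h x
    have h' := h (u.1 x)
    simpa using h'.symm
  · intro h x
    have h' := h ((u⁻¹ : WA N).1 x)
    simpa using h'.symm

theorem invariants_pow {N : ℕ} {w : WA N} {f : Twisted N} (hf : f ∈ invariants w) (i : ℕ) (x : ℤ) :
    f.1 ((w.1 ^ i) x) = f.1 x := by
  induction i with
  | zero => simp
  | succ i ih => rw [pow_succ', Equiv.Perm.mul_apply, mem_invariants.1 hf, ih]

/-- If a power of `w` translates `x`, the invariant functions vanish at `x`. -/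
theorem invariants_eq_zero {N : ℕ} {w : WA N} {f : Twisted N} (hf : f ∈ invariants w) {i : ℕ}
    {x s : ℤ} (h : (w.1 ^ i) x = x + s * N) (hs : s ≠ 0) : f.1 x = 0 := by
  have h1 := invariants_pow hf i x
  rw [h, twisted_apply_add_mul] at h1
  by_contra h2
  exact hs (two_zpow_eq_one (mul_right_cancel₀ h2 (h1.trans (one_mul _).symm)))

theorem mem_invariants_of_isTransposition {N : ℕ} {a b : ℤ} {t : WA N}
    (ht : IsTransposition N a b t.1) {f : Twisted N} (hf : f.1 a = f.1 b) : f ∈ invariants t := by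
  refine mem_invariants.2 fun x => ?_
  by_cases ha : x ≡ a [ZMOD N]
  · obtain ⟨j, rfl⟩ := ha.exists_eq_add_mul
    rw [(ht.1 j).1, twisted_apply_add_mul, twisted_apply_add_mul, hf]
  by_cases hb : x ≡ b [ZMOD N]
  · obtain ⟨j, rfl⟩ := hb.exists_eq_add_mul
    rw [(ht.1 j).2, twisted_apply_add_mul, twisted_apply_add_mul, hf]
  rw [ht.2 x ha hb]

/-! ### Codimension of the invariants: subadditivity and faithfulness -/

section Codim

variable {N : ℕ} [NeZero N]

theorem invDim_le (w : WA N) : invDim w ≤ N :=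
  (Submodule.finrank_le _).trans_eq (finrank_twisted N)

theorem invDim_one : invDim (1 : WA N) = N := by
  rw [invDim, invariants_one, finrank_top, finrank_twisted]

theorem finrank_inf_ge (S T : Submodule ℚ (Twisted N)) :
    finrank ℚ S + finrank ℚ T ≤ N + finrank ℚ ↥(S ⊓ T) := by
  have h := Submodule.finrank_sup_add_finrank_inf_eq S T
  have h2 := (Submodule.finrank_le (S ⊔ T)).trans_eq (finrank_twisted N)
  omega

/-- Functions invariant by both factors are invariant by the product. This is subadditivity of the
codimension `N - invDim`. -/
theorem invDim_mul (u v : WA N) : invDim u + invDim v ≤ N + invDim (u * v) :=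
  (finrank_inf_ge _ _).trans
    (Nat.add_le_add_left (Submodule.finrank_mono (inf_invariants_le u v)) _)

theorem invDim_conj_le (g u : WA N) : invDim u ≤ invDim (g⁻¹ * u * g) := by
  refine LinearMap.finrank_le_finrank_of_injective
    (f := (pullback g).restrict (p := invariants u) (q := invariants (g⁻¹ * u * g)) ?_) ?_
  · intro f hf
    have hf := mem_invariants.1 hf
    refine mem_invariants.2 fun x => ?_
    change f.1 (g.1 (g.1.symm (u.1 (g.1 x)))) = f.1 (g.1 x)
    rw [Equiv.apply_symm_apply, hf]
  · intro f f' h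
    apply Subtype.ext
    apply Subtype.ext
    funext x
    have := congrFun (congrArg Subtype.val (congrArg Subtype.val h)) (g.1.symm x)
    change f.1.1 (g.1 (g.1.symm x)) = f'.1.1 (g.1 (g.1.symm x)) at this
    simpa using this

theorem invDim_conj (g u : WA N) : invDim (g⁻¹ * u * g) = invDim u := by
  refine le_antisymm ?_ (invDim_conj_le g u)
  have := invDim_conj_le g⁻¹ (g⁻¹ * u * g)
  have e : g⁻¹⁻¹ * (g⁻¹ * u * g) * g⁻¹ = u := by group
  rwa [e] at this

/-- One linear condition, equality of the values at `a` and `b`, suffices for invariance. -/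
theorem invDim_reflection {t : WA N} (ht : t ∈ reflections N) : N ≤ invDim t + 1 := by
  obtain ⟨a, b, -, h⟩ := ht
  let φ : Twisted N →ₗ[ℚ] ℚ :=
    { toFun := fun f => f.1 a - f.1 b
      map_add' := fun f g => by simp; ring
      map_smul' := fun r f => by simp; ring }
  have hle : LinearMap.ker φ ≤ invariants t := fun f hf =>
    mem_invariants_of_isTransposition h (sub_eq_zero.1 hf)
  have h3 := φ.finrank_range_add_finrank_ker
  rw [finrank_twisted] at h3
  have h4 : finrank ℚ (LinearMap.range φ) ≤ 1 :=
    (Submodule.finrank_le _).trans_eq (finrank_self ℚ)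
  have h5 := Submodule.finrank_mono hle
  unfold invDim
  omega

/-- The action is faithful: the function supported on the class of `x` detects a change of class,
and its powers of 2 detect a translation inside the class. -/
theorem eq_one_of_invDim_eq {w : WA N} (h : invDim w = N) : w = 1 := by
  have h' : invariants w = ⊤ := Submodule.eq_top_of_finrank_eq (by rw [finrank_twisted]; exact h)
  apply Subtype.ext
  ext x
  have hx : twistedSingle N x ∈ invariants w := by rw [h']; trivial
  have h1 := mem_invariants.1 hx x
  rw [twistedSingle_self] at h1
  by_cases hm : w.1 x ≡ x [ZMOD N]
  · obtain ⟨j, hj⟩ := hm.exists_eq_add_mul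
    rw [hj, twistedSingle_add_mul] at h1
    simp [hj, two_zpow_eq_one h1]
  · rw [twistedSingle_of_not_modEq hm] at h1
    norm_num at h1

/-- Every point is translated by some power of `w`. -/
theorem exists_pow_eq_add_mul (w : WA N) (x : ℤ) :
    ∃ i : ℕ, 0 < i ∧ ∃ s : ℤ, (w.1 ^ i) x = x + s * N := by
  obtain ⟨i, j, hij, h⟩ := Finite.exists_ne_map_eq_of_infinite
    (fun i : ℕ => (((w.1 ^ i) x : ℤ) : ZMod N))
  wlog hlt : i < j generalizing i j
  · exact this j i hij.symm h.symm (lt_of_le_of_ne (not_lt.1 hlt) hij.symm)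
  obtain ⟨s, hs⟩ := ((ZMod.intCast_eq_intCast_iff _ _ _).1 h.symm).exists_eq_add_mul
  refine ⟨j - i, by omega, s, ?_⟩
  apply (w.1 ^ i).injective
  have hp : IsPeriodic N (w.1 ^ i) := ((WA N).pow_mem w.2 i).1
  rw [hp.add_mul, ← hs, ← Equiv.Perm.mul_apply, ← pow_add]
  congr 2
  omega

end Codim

/-! ## The order of the boundary of the strip -/

/-- The order for which the odd integers increase and are followed by the even integers, which
decrease: `x` precedes `y` when `stripKey x < stripKey y`. -/
def stripKey (x : ℤ) : ℤ ×ₗ ℤ := if x % 2 = 1 then toLex (0, x) else toLex (1, -x)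

theorem stripKey_lt_iff {x y : ℤ} : stripKey x < stripKey y ↔
    (x % 2 = 1 ∧ y % 2 = 1 ∧ x < y) ∨ (x % 2 = 1 ∧ y % 2 = 0) ∨
      (x % 2 = 0 ∧ y % 2 = 0 ∧ y < x) := by
  unfold stripKey
  split_ifs <;> simp [Prod.Lex.toLex_lt_toLex] <;> omega

theorem stripKey_le_iff {x y : ℤ} : stripKey x ≤ stripKey y ↔
    (x % 2 = 1 ∧ y % 2 = 1 ∧ x ≤ y) ∨ (x % 2 = 1 ∧ y % 2 = 0) ∨
      (x % 2 = 0 ∧ y % 2 = 0 ∧ y ≤ x) := by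
  rw [← not_lt, stripKey_lt_iff]
  omega

theorem stripKey_injective : Function.Injective stripKey := fun x y h => by
  have h1 := stripKey_le_iff.1 h.le
  have h2 := stripKey_le_iff.1 h.ge
  omega

theorem add_mul_emod_two (n : ℕ) (x j : ℤ) : (x + j * ((2 * n : ℕ) : ℤ)) % 2 = x % 2 := by
  have : x + j * ((2 * n : ℕ) : ℤ) = x + 2 * (j * n) := by push_cast; ring
  rw [this]
  omega

theorem stripKey_add_mul_lt (n : ℕ) (x y j : ℤ) :
    stripKey (x + j * ((2 * n : ℕ) : ℤ)) < stripKey (y + j * ((2 * n : ℕ) : ℤ)) ↔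
      stripKey x < stripKey y := by
  simp only [stripKey_lt_iff, add_mul_emod_two]
  omega

theorem stripKey_add_mul_le (n : ℕ) (x y j : ℤ) :
    stripKey (x + j * ((2 * n : ℕ) : ℤ)) ≤ stripKey (y + j * ((2 * n : ℕ) : ℤ)) ↔
      stripKey x ≤ stripKey y := by
  rw [← not_lt, ← not_lt, stripKey_add_mul_lt]

theorem cPerm_apply (x : ℤ) : cPerm x = if x % 2 = 1 then x + 2 else x - 2 := by
  simp only [cPerm, Equiv.coe_fn_mk, Int.odd_iff]

/-- The point `cPerm x` is the immediate successor of `x`. There is no exception at the junction,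
since there is neither a last odd nor a first even integer. -/
theorem stripKey_lt_iff_cPerm_le {x y : ℤ} :
    stripKey x < stripKey y ↔ stripKey (cPerm x) ≤ stripKey y := by
  rw [stripKey_lt_iff, stripKey_le_iff, cPerm_apply]
  split_ifs <;> omega

theorem stripKey_lt_cPerm_iff_le {x y : ℤ} :
    stripKey x < stripKey (cPerm y) ↔ stripKey x ≤ stripKey y := by
  rw [stripKey_lt_iff, stripKey_le_iff, cPerm_apply]
  split_ifs <;> omega

/-! ## Descents -/

/-- The point `x` is a (weak) descent of `w`. -/
def IsDescent (w : Equiv.Perm ℤ) (x : ℤ) : Prop := stripKey (w x) ≤ stripKey x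

theorem isDescent_add_mul {n : ℕ} (w : WA (2 * n)) (x j : ℤ) :
    IsDescent w.1 (x + j * ((2 * n : ℕ) : ℤ)) ↔ IsDescent w.1 x := by
  unfold IsDescent
  rw [w.2.1.add_mul, stripKey_add_mul_le]

open Classical in
/-- The descents of `w` in a period. -/
noncomputable def descents {n : ℕ} (w : WA (2 * n)) : Finset ℤ :=
  (Finset.Icc (1 : ℤ) ((2 * n : ℕ) : ℤ)).filter (IsDescent w.1)

theorem exists_add_mul_mem_Icc (N : ℕ) [NeZero N] (x : ℤ) :
    ∃ j : ℤ, x + j * N ∈ Finset.Icc (1 : ℤ) N := by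
  have hN : (0 : ℤ) < N := Int.natCast_pos.2 (NeZero.pos N)
  refine ⟨-((x - 1) / N), ?_⟩
  have h1 := Int.emod_nonneg (x - 1) hN.ne'
  have h2 := Int.emod_lt_of_pos (x - 1) hN
  have h3 := Int.emod_add_mul_ediv (x - 1) N
  rw [Finset.mem_Icc]
  constructor <;> linarith

/-- With `b = w⁻¹ c`, the image by `w` of `b x` is the successor of `x`; so `b x` is a descent of
`w` exactly when `x` is not a descent of `b`. Since `b` permutes the classes modulo `2n`, each class
is counted once. -/
theorem card_descents_add {n : ℕ} (w : WA (2 * n)) :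
    (descents w).card + (descents (w⁻¹ * coxeterC n)).card = 2 * n := by
  classical
  set b := w⁻¹ * coxeterC n with hb
  have hwb : ∀ x, w.1 (b.1 x) = cPerm x := fun x => by
    change w.1 (w.1.symm (cPerm x)) = _
    simp
  have h := sum_period b.2.1 (fun x => if IsDescent w.1 x then (1 : ℚ) else 0)
    (fun i k => by simp only [isDescent_add_mul])
  have h2 : ∑ x ∈ Finset.Icc (1 : ℤ) ((2 * n : ℕ) : ℤ),
      ((if IsDescent w.1 (b.1 x) then (1 : ℚ) else 0)
      + (if IsDescent b.1 x then (1 : ℚ) else 0)) = ((2 * n : ℕ) : ℚ) := by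
    rw [Finset.sum_congr rfl (g := fun _ => (1 : ℚ))]
    · rw [Finset.sum_const, Int.card_Icc, nsmul_one]
      congr 1
      omega
    · intro x _
      have : IsDescent w.1 (b.1 x) ↔ ¬ IsDescent b.1 x := by
        unfold IsDescent
        rw [hwb, not_le, stripKey_lt_iff_cPerm_le]
      by_cases hd : IsDescent b.1 x <;> simp [this, hd]
  rw [Finset.sum_add_distrib, h, Finset.sum_boole, Finset.sum_boole] at h2
  exact_mod_cast h2

/-- A sequence which increases strictly up to the index `m` crosses each value in one step. -/
theorem exists_step {α : Type*} [LinearOrder α] (y : ℕ → α) (m : ℕ) (h : ∀ i < m, y i < y (i + 1)) :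
    y 0 ≤ y m ∧ ∀ u, y 0 < u → u ≤ y m →
      ∃ i < m, y 0 ≤ y i ∧ y i < u ∧ u ≤ y (i + 1) ∧ y (i + 1) ≤ y m := by
  induction m with
  | zero => exact ⟨le_rfl, fun u h1 h2 => absurd h1 (not_lt.2 h2)⟩
  | succ m ih =>
    obtain ⟨h1, h2⟩ := ih fun i hi => h i (by omega)
    have h3 := h m (by omega)
    refine ⟨h1.trans h3.le, fun u hu hu' => ?_⟩
    by_cases hm : u ≤ y m
    · obtain ⟨i, hi, a, b, c, d⟩ := h2 u hu hm
      exact ⟨i, by omega, a, b, c, d.trans h3.le⟩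
    · exact ⟨m, by omega, h1, not_le.1 hm, hu', le_rfl⟩

/-- A finite orbit contains a descent. -/
theorem exists_isDescent_of_pow_eq {w : Equiv.Perm ℤ} {x : ℤ} {i : ℕ} (hi : 0 < i)
    (h : (w ^ i) x = x) : ∃ m, IsDescent w ((w ^ m) x) := by
  by_contra! hc
  have hs : ∀ m, stripKey ((w ^ m) x) < stripKey ((w ^ (m + 1)) x) := fun m => by
    have := hc m
    unfold IsDescent at this
    rwa [not_le, ← Equiv.Perm.mul_apply, ← pow_succ'] at this
  obtain ⟨j, rfl⟩ : ∃ j, i = j + 1 := ⟨i - 1, by omega⟩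
  have h1 := (exists_step (fun m => stripKey ((w ^ m) x)) j fun m _ => hs m).1
  have h2 := hs j
  rw [h] at h2
  exact absurd h1 (not_le.2 (by simpa using h2))

/-- Invariant functions separate the classes of descents of `w`; in other words each finite
orbit has exactly one descent and the other orbits have none. -/
def SeparatesDescents {n : ℕ} (w : WA (2 * n)) : Prop :=
  ∀ d, IsDescent w.1 d → ∃ f ∈ invariants w, f.1 d = 1 ∧
    ∀ d', IsDescent w.1 d' → ¬ d' ≡ d [ZMOD ((2 * n : ℕ) : ℤ)] → f.1 d' = 0

section Interpolation

variable {K V ι : Type*} [Field K] [AddCommGroup V] [Module K V] [FiniteDimensional K V] [Fintype ι]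

theorem finrank_le_card_of_separating (S : Submodule K V) (φ : V →ₗ[K] (ι → K))
    (h : ∀ f ∈ S, φ f = 0 → f = 0) :
    finrank K S ≤ Fintype.card ι ∧ (finrank K S = Fintype.card ι → ∀ g, ∃ f ∈ S, φ f = g) := by
  have hi : Function.Injective (φ.domRestrict S) := by
    refine (injective_iff_map_eq_zero (φ.domRestrict S)).2 fun f hf => ?_
    exact Subtype.ext (h f.1 f.2 hf)
  refine ⟨by simpa using LinearMap.finrank_le_finrank_of_injective hi, fun hc g => ?_⟩
  obtain ⟨f, hf⟩ := (LinearMap.injective_iff_surjective_of_finrank_eq_finrank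
    (by simpa using hc)).1 hi g
  exact ⟨f.1, f.2, hf⟩

theorem card_le_finrank_of_interpolating (S : Submodule K V) (φ : V →ₗ[K] (ι → K))
    (h : ∀ g, ∃ f ∈ S, φ f = g) : Fintype.card ι ≤ finrank K S := by
  have hs : Function.Surjective (φ.domRestrict S) := fun g => by
    obtain ⟨f, hf, e⟩ := h g
    exact ⟨⟨f, hf⟩, e⟩
  simpa using LinearMap.finrank_le_finrank_of_surjective hs

end Interpolation

/-! ### Counting finite orbits by descents; the criterion for dual elements -/

section Descents

variable {n : ℕ} [NeZero (2 * n)]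

/-- The values of invariant functions at the descents. -/
noncomputable def evalDescents (w : WA (2 * n)) : Twisted (2 * n) →ₗ[ℚ] (descents w → ℚ) where
  toFun f d := f.1 d
  map_add' _ _ := rfl
  map_smul' _ _ := rfl

/-- Each finite orbit contains a descent, which determines the value there, and invariant functions
vanish on infinite orbits. -/
theorem eq_zero_of_evalDescents_eq_zero (w : WA (2 * n)) (f : Twisted (2 * n))
    (hfw : f ∈ invariants w) (hf : evalDescents w f = 0) : f = 0 := by
  classical
  have h1 : ∀ d, IsDescent w.1 d → f.1 d = 0 := by
    intro d hd
    obtain ⟨j, hj⟩ := exists_add_mul_mem_Icc (2 * n) d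
    have := congrFun hf ⟨_, Finset.mem_filter.2 ⟨hj, (isDescent_add_mul w d j).2 hd⟩⟩
    change f.1 (d + j * ((2 * n : ℕ) : ℤ)) = 0 at this
    rw [twisted_apply_add_mul] at this
    exact (mul_eq_zero.1 this).resolve_left (zpow_ne_zero _ (by norm_num))
  apply Subtype.ext
  funext x
  obtain ⟨i, hi, s, hs⟩ := exists_pow_eq_add_mul w x
  by_cases h0 : s = 0
  · rw [h0, zero_mul, add_zero] at hs
    obtain ⟨m, hm⟩ := exists_isDescent_of_pow_eq hi hs
    have := h1 _ hm
    rwa [invariants_pow hfw] at this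
  · exact invariants_eq_zero hfw hs h0

theorem invDim_le_card_descents (w : WA (2 * n)) : invDim w ≤ (descents w).card := by
  have := (finrank_le_card_of_separating _ _ (eq_zero_of_evalDescents_eq_zero w)).1
  rwa [Fintype.card_coe] at this

/-- Evaluation at the descents is injective on invariants. Equality of dimensions makes it
bijective, and the separating functions are then the dual basis, rescaled because a descent need not
lie in the chosen period. -/
theorem invDim_eq_iff_separatesDescents (w : WA (2 * n)) :
    invDim w = (descents w).card ↔ SeparatesDescents w := by
  classical
  have hN : (2 * n : ℕ) ≠ 0 := NeZero.ne _
  constructor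
  · intro h d hd
    have hs := (finrank_le_card_of_separating _ _ (eq_zero_of_evalDescents_eq_zero w)).2
      (by rw [Fintype.card_coe]; exact h)
    obtain ⟨j, hj⟩ := exists_add_mul_mem_Icc (2 * n) d
    have hd0 := Finset.mem_filter.2 ⟨hj, (isDescent_add_mul w d j).2 hd⟩
    obtain ⟨f, hfw, hf⟩ := hs (Pi.single ⟨_, hd0⟩ (2 ^ j))
    refine ⟨f, hfw, ?_, fun d' hd' hdd' => ?_⟩
    · have := congrFun hf ⟨_, hd0⟩
      rw [Pi.single_eq_same] at this
      change f.1 (d + j * ((2 * n : ℕ) : ℤ)) = 2 ^ j at this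
      rw [twisted_apply_add_mul] at this
      exact mul_left_cancel₀ (zpow_ne_zero j (by norm_num : (2 : ℚ) ≠ 0)) (by rw [this, mul_one])
    · obtain ⟨i, hi⟩ := exists_add_mul_mem_Icc (2 * n) d'
      have hd1 := Finset.mem_filter.2 ⟨hi, (isDescent_add_mul w d' i).2 hd'⟩
      have := congrFun hf ⟨_, hd1⟩
      rw [Pi.single_eq_of_ne] at this
      · change f.1 (d' + i * ((2 * n : ℕ) : ℤ)) = 0 at this
        rw [twisted_apply_add_mul] at this
        exact (mul_eq_zero.1 this).resolve_left (zpow_ne_zero _ (by norm_num))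
      · intro he
        have he : d' + i * ((2 * n : ℕ) : ℤ) = d + j * ((2 * n : ℕ) : ℤ) :=
          congrArg Subtype.val he
        exact hdd' ((Int.add_mul_modEq _ d' i).symm.trans
          (he ▸ Int.add_mul_modEq _ d j))
  · intro h
    refine le_antisymm (invDim_le_card_descents w) ?_
    have hs : ∀ g, ∃ f ∈ invariants w, evalDescents w f = g := by
      choose f hf h1 h2 using fun d : descents w => h d (Finset.mem_filter.1 d.2).2
      intro g
      refine ⟨∑ d, g d • f d, Submodule.sum_mem _ fun d _ => Submodule.smul_mem _ _ (hf d), ?_⟩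
      rw [map_sum]
      funext e
      rw [Finset.sum_apply, Finset.sum_eq_single e]
      · rw [map_smul]
        change g e * (f e).1 e = _
        rw [h1, mul_one]
      · intro d _ hde
        rw [map_smul]
        change g d * (f d).1 e = 0
        rw [h2 d e (Finset.mem_filter.1 e.2).2, mul_zero]
        intro hm
        apply hde
        have a1 := Finset.mem_Icc.1 (Finset.mem_filter.1 e.2).1
        have a2 := Finset.mem_Icc.1 (Finset.mem_filter.1 d.2).1
        have h3 : (e : ℤ) - 1 ≡ d - 1 [ZMOD ((2 * n : ℕ) : ℤ)] := hm.sub_right 1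
        unfold Int.ModEq at h3
        rw [Int.emod_eq_of_lt (by omega) (by omega), Int.emod_eq_of_lt (by omega) (by omega)] at h3
        exact Subtype.ext (by omega)
      · simp
    have := card_le_finrank_of_interpolating _ _ hs
    rwa [Fintype.card_coe] at this

/-- The dimension condition which characterizes the divisors of `c`. -/
def IsDual (w : WA (2 * n)) : Prop := invDim w + invDim (w⁻¹ * coxeterC n) = 2 * n

/-- Both dimensions are bounded by numbers of descents whose sum is `2n`, so the sum of the
dimensions is `2n` exactly when both bounds are attained. -/
theorem isDual_iff (w : WA (2 * n)) :
    IsDual w ↔ SeparatesDescents w ∧ SeparatesDescents (w⁻¹ * coxeterC n) := by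
  rw [← invDim_eq_iff_separatesDescents, ← invDim_eq_iff_separatesDescents]
  have h1 := invDim_le_card_descents w
  have h2 := invDim_le_card_descents (w⁻¹ * coxeterC n)
  have h3 := card_descents_add w
  unfold IsDual
  omega

/-- From the image of a descent, the orbit increases until it comes back to the descent. -/
theorem SeparatesDescents.exists_pow {w : WA (2 * n)} (hw : SeparatesDescents w) {z : ℤ}
    (hz : IsDescent w.1 z) : ∃ m : ℕ, (w.1 ^ m) (w.1 z) = z ∧
      ∀ i < m, stripKey ((w.1 ^ i) (w.1 z)) < stripKey ((w.1 ^ (i + 1)) (w.1 z)) := by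
  classical
  obtain ⟨f, hf, h1, h2⟩ := hw z hz
  have hex : ∃ m : ℕ, (w.1 ^ m) (w.1 z) = z := by
    obtain ⟨i, hi, s, hs⟩ := exists_pow_eq_add_mul w z
    have h0 : s = 0 := by
      by_contra h0
      rw [invariants_eq_zero hf hs h0] at h1
      norm_num at h1
    refine ⟨i - 1, ?_⟩
    rw [← Equiv.Perm.mul_apply, ← pow_succ, Nat.sub_add_cancel hi, hs, h0]
    simp
  refine ⟨Nat.find hex, Nat.find_spec hex, fun i hi => ?_⟩
  by_contra hc
  rw [not_lt, pow_succ', Equiv.Perm.mul_apply] at hc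
  have hne := Nat.find_min hex hi
  set y := (w.1 ^ i) (w.1 z) with hy
  have hfy : f.1 y = 1 := by rw [hy, invariants_pow hf, mem_invariants.1 hf, h1]
  by_cases hm : y ≡ z [ZMOD ((2 * n : ℕ) : ℤ)]
  · obtain ⟨j, hj⟩ := hm.exists_eq_add_mul
    rw [hj, twisted_apply_add_mul, h1, mul_one] at hfy
    rw [two_zpow_eq_one hfy] at hj
    exact hne (by simpa using hj)
  · rw [h2 y hc hm] at hfy
    norm_num at hfy

/-- The orbit climbs from `w z` to `z`, so one of its steps passes over the level `u`. -/
theorem SeparatesDescents.exists_arc {w : WA (2 * n)} (hw : SeparatesDescents w) {z u : ℤ}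
    (hz : IsDescent w.1 z) (h1 : stripKey (w.1 z) < stripKey u) (h2 : stripKey u ≤ stripKey z) :
    ∃ y, stripKey (w.1 z) ≤ stripKey y ∧ stripKey y < stripKey u ∧
      stripKey u ≤ stripKey (w.1 y) ∧ stripKey (w.1 y) ≤ stripKey z := by
  obtain ⟨m, hm, hlt⟩ := hw.exists_pow hz
  obtain ⟨i, -, a, b, c, d⟩ := (exists_step (fun i => stripKey ((w.1 ^ i) (w.1 z))) m hlt).2
    (stripKey u) (by simpa using h1) (by rw [hm]; exact h2)
  refine ⟨(w.1 ^ i) (w.1 z), by simpa using a, b, ?_, ?_⟩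
  · rwa [pow_succ', Equiv.Perm.mul_apply] at c
  · rwa [pow_succ', Equiv.Perm.mul_apply, hm] at d

/-- Ascents of a dual element do not cross. -/
theorem IsDual.not_crossing {w : WA (2 * n)} (hw : IsDual w) {v x : ℤ}
    (h1 : stripKey v < stripKey x) (h2 : stripKey x < stripKey (w.1 v))
    (h3 : stripKey (w.1 v) < stripKey (w.1 x)) : False := by
  obtain ⟨hs, hs'⟩ := (isDual_iff w).1 hw
  set b := w⁻¹ * coxeterC n with hb
  have hwb : ∀ x, w.1 (b.1 x) = cPerm x := fun x => by
    change w.1 (w.1.symm (cPerm x)) = _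
    simp
  -- Infinite descent: a crossing yields another one nested in it, from `r` with `x < r < w v < w r
  -- < w x` in the strip order. Intervals joining odd to even points are infinite, so the measure is
  -- taken on an interval within one parity: from `x` to `w v` if `w v` is odd, from `w v` to `w x`
  -- otherwise.
  generalize hM : (if w.1 v % 2 = 1 then (w.1 v - x).toNat else (w.1 v - w.1 x).toNat) = M
  induction M using Nat.strong_induction_on generalizing x with
  | _ M ih =>
  obtain ⟨z0, hz0⟩ : ∃ z0, cPerm z0 = w.1 x := cPerm.surjective _
  have hbz0 : b.1 z0 = x := w.1.injective (by rw [hwb, hz0])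
  have hd0 : IsDescent b.1 z0 := by
    unfold IsDescent
    rw [hbz0, ← stripKey_lt_cPerm_iff_le, hz0]
    exact h2.trans h3
  -- The orbit of `b` climbs from `x` to `z0`, the predecessor of `w x`, and so steps over `w v`,
  -- from `z` to `b z`.
  obtain ⟨z, a1, a2, a3, a4⟩ := hs'.exists_arc hd0 (u := w.1 v) (by rwa [hbz0])
    (by rwa [← stripKey_lt_cPerm_iff_le, hz0])
  rw [hbz0] at a1
  have a5 : stripKey z < stripKey (cPerm z) := stripKey_lt_cPerm_iff_le.2 le_rfl
  have a6 : stripKey (cPerm z) < stripKey (w.1 v) := by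
    refine lt_of_le_of_ne (stripKey_lt_iff_cPerm_le.1 a2) fun he => ?_
    have he := stripKey_injective he
    rw [← hwb] at he
    rw [w.1.injective he] at a3
    exact absurd (h1.trans h2) (not_lt.2 a3)
  -- As `w (b z)` is the successor of `z`, the point `b z` is a descent of `w`; the orbit of `w`
  -- ending there steps over `w v` in turn.
  obtain ⟨r, r1, r2, r3, r4⟩ := hs.exists_arc (z := b.1 z) (u := w.1 v)
    (by unfold IsDescent; rw [hwb]; exact (a6.trans_le a3).le) (by rwa [hwb]) a3
  rw [hwb] at r1
  have hxr : stripKey x < stripKey r := (a1.trans_lt a5).trans_le r1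
  have r5 : stripKey (w.1 v) < stripKey (w.1 r) := by
    refine lt_of_le_of_ne r3 fun he => ?_
    have he := w.1.injective (stripKey_injective he)
    rw [he] at h1
    exact absurd (h1.trans hxr) (lt_irrefl _)
  have r6 : stripKey (w.1 r) < stripKey (w.1 x) := by
    rw [← hz0, stripKey_lt_cPerm_iff_le]
    exact r4.trans a4
  refine ih _ ?_ (h1.trans hxr) r2 r5 rfl
  rw [← hM]
  rw [stripKey_lt_iff] at hxr r2 r5 r6
  split_ifs <;> omega

end Descents

/-! ## Reflections -/

theorem exists_isTransposition {N : ℕ} {a b : ℤ} (h : ¬ a ≡ b [ZMOD N]) :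
    ∃ t : WA N, t ∈ reflections N ∧ IsTransposition N a b t.1 := by
  have hab : ¬ (N : ℤ) ∣ b - a := fun h' => h (Int.modEq_iff_dvd.2 h')
  have hba : ¬ (N : ℤ) ∣ a - b := fun h' => h (Int.modEq_iff_dvd.2 h').symm
  let φ : ℤ → ℤ := fun x =>
    if (N : ℤ) ∣ x - a then x - a + b else if (N : ℤ) ∣ x - b then x - b + a else x
  have h1 : ∀ x, (N : ℤ) ∣ x - a → φ x = x - a + b := fun x hx => by simp [φ, hx]
  have h2 : ∀ x, (N : ℤ) ∣ x - b → φ x = x - b + a := fun x hx => by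
    have : ¬ (N : ℤ) ∣ x - a := fun hx' => hab (by
      have := dvd_sub hx' hx
      rwa [show x - a - (x - b) = b - a by ring] at this)
    simp [φ, hx, this]
  have h3 : ∀ x, ¬ (N : ℤ) ∣ x - a → ¬ (N : ℤ) ∣ x - b → φ x = x := fun x hx hx' => by
    simp [φ, hx, hx']
  have hinv : Function.Involutive φ := fun x => by
    by_cases ha : (N : ℤ) ∣ x - a
    · rw [h1 x ha, h2 _ (by simpa using ha)]
      ring
    by_cases hb : (N : ℤ) ∣ x - b
    · rw [h2 x hb, h1 _ (by simpa using hb)]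
      ring
    rw [h3 x ha hb, h3 x ha hb]
  have hp : IsPeriodic N hinv.toPerm := fun x => by
    change φ (x + N) = φ x + N
    have ea : x + N - a = x - a + N := by ring
    have eb : x + N - b = x - b + N := by ring
    simp only [φ, ea, eb, dvd_add_self_right]
    split_ifs <;> ring
  have hs : totalShift N hinv.toPerm = 0 := by
    have e := totalShift_mul hp hp
    have e2 : hinv.toPerm * hinv.toPerm = 1 := by
      ext x
      exact hinv x
    rw [e2, ((WA N).one_mem).2] at e
    linarith
  have ht : IsTransposition N a b hinv.toPerm := by
    refine ⟨fun k => ⟨?_, ?_⟩, fun x hxa hxb => h3 x (fun h' => hxa (Int.modEq_iff_dvd.2 h').symm)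
      (fun h' => hxb (Int.modEq_iff_dvd.2 h').symm)⟩
    · change φ _ = _
      rw [h1 _ (by simp)]
      ring
    · change φ _ = _
      rw [h2 _ (by simp)]
      ring
  exact ⟨⟨hinv.toPerm, hp, hs⟩, ⟨a, b, h, ht⟩, ht⟩

theorem mul_self_of_mem_reflections {N : ℕ} {t : WA N} (ht : t ∈ reflections N) : t * t = 1 := by
  obtain ⟨a, b, -, h1, h2⟩ := ht
  apply Subtype.ext
  ext x
  change t.1 (t.1 x) = x
  by_cases ha : x ≡ a [ZMOD N]
  · obtain ⟨j, rfl⟩ := ha.exists_eq_add_mul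
    rw [(h1 j).1, (h1 j).2]
  by_cases hb : x ≡ b [ZMOD N]
  · obtain ⟨j, rfl⟩ := hb.exists_eq_add_mul
    rw [(h1 j).2, (h1 j).1]
  rw [h2 x ha hb, h2 x ha hb]

/-- A periodic permutation of total shift zero which moves no integer to the right is trivial. -/
theorem eq_one_of_apply_le {N : ℕ} [NeZero N] {w : WA N} (h : ∀ x, w.1 x ≤ x) : w = 1 := by
  have hN : (N : ℚ) ≠ 0 := Nat.cast_ne_zero.2 (NeZero.ne N)
  have h0 : ∑ x ∈ Finset.Icc (1 : ℤ) N, ((w.1 x - x : ℤ) : ℚ) = 0 := by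
    have := w.2.2
    unfold totalShift at this
    exact (mul_eq_zero.1 this).resolve_left (by positivity)
  have h1 := (Finset.sum_eq_zero_iff_of_nonpos (fun x _ => by
    have := h x
    exact_mod_cast (by omega : w.1 x - x ≤ 0))).1 h0
  apply Subtype.ext
  ext x
  obtain ⟨j, hj⟩ := exists_add_mul_mem_Icc N x
  have h2 : w.1 (x + j * N) - (x + j * N) = 0 := by exact_mod_cast h1 _ hj
  rw [w.2.1.add_mul] at h2
  change w.1 x = x
  linarith

theorem eq_one_of_le_apply {N : ℕ} [NeZero N] {w : WA N} (h : ∀ x, x ≤ w.1 x) : w = 1 := by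
  rw [← inv_eq_one]
  refine eq_one_of_apply_le fun x => ?_
  have := h (w.1.symm x)
  rw [Equiv.apply_symm_apply] at this
  exact this

/-- Invariants of `w` that agree at `a` and `b` remain invariant by `t w`; the function `f` is a new
one. -/
theorem invDim_lt_of_mul {N : ℕ} [NeZero N] {a b : ℤ} {t w : WA N} (ht : IsTransposition N a b t.1)
    (h : ∀ f ∈ invariants w, f.1 a = f.1 b) {f : Twisted N} (hf : f ∈ invariants (t * w))
    (hf' : f ∉ invariants w) : invDim w < invDim (t * w) := by
  have hle : invariants w ≤ invariants (t * w) := fun g hg =>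
    inf_invariants_le t w ⟨mem_invariants_of_isTransposition ht (h g hg), hg⟩
  exact Submodule.finrank_lt_finrank_of_lt (lt_of_le_of_ne hle fun he => hf' (he ▸ hf))

theorem invDim_coxeterC (n : ℕ) : invDim (coxeterC n) = 0 := by
  have h1 : ∀ x : ℤ, x % 2 = 1 → ∀ i : ℕ, (cPerm ^ i) x = x + 2 * i := by
    intro x hx i
    induction i with
    | zero => simp
    | succ i ih =>
      rw [pow_succ', Equiv.Perm.mul_apply, ih, cPerm_apply, if_pos (by omega)]
      push_cast
      ring
  have h2 : ∀ x : ℤ, x % 2 = 0 → ∀ i : ℕ, (cPerm ^ i) x = x - 2 * i := by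
    intro x hx i
    induction i with
    | zero => simp
    | succ i ih =>
      rw [pow_succ', Equiv.Perm.mul_apply, ih, cPerm_apply, if_neg (by omega)]
      push_cast
      ring
  have : invariants (coxeterC n) = ⊥ := by
    rw [eq_bot_iff]
    intro f hf
    apply Subtype.ext
    funext x
    change f.1 x = 0
    rcases Int.emod_two_eq_zero_or_one x with hx | hx
    · refine invariants_eq_zero hf (i := n) (s := -1) ?_ (by norm_num)
      change (cPerm ^ n) x = _
      rw [h2 x hx]
      push_cast
      ring
    · refine invariants_eq_zero hf (i := n) (s := 1) ?_ (by norm_num)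
      change (cPerm ^ n) x = _
      rw [h1 x hx]
      push_cast
      ring
  rw [invDim, this, finrank_bot]

/-- `w` is a product of reflections. -/
def IsReflectionProd {n : ℕ} (w : WA (2 * n)) : Prop :=
  ∃ L : List (WA (2 * n)), (∀ t ∈ L, t ∈ reflections (2 * n)) ∧ L.prod = w

theorem IsReflectionProd.mul {n : ℕ} {u v : WA (2 * n)} (hu : IsReflectionProd u)
    (hv : IsReflectionProd v) : IsReflectionProd (u * v) := by
  obtain ⟨L, hL, rfl⟩ := hu
  obtain ⟨M, hM, rfl⟩ := hv
  refine ⟨L ++ M, fun t ht => ?_, List.prod_append⟩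
  rcases List.mem_append.1 ht with h | h
  · exact hL t h
  · exact hM t h

theorem IsReflectionProd.inv {n : ℕ} {u : WA (2 * n)} (hu : IsReflectionProd u) :
    IsReflectionProd u⁻¹ := by
  obtain ⟨L, hL, rfl⟩ := hu
  refine ⟨(L.map fun t => t⁻¹).reverse, fun t ht => ?_, (List.prod_inv_reverse L).symm⟩
  obtain ⟨s, hs, rfl⟩ := List.mem_map.1 (List.mem_reverse.1 ht)
  rw [inv_eq_of_mul_eq_one_right (mul_self_of_mem_reflections (hL s hs))]
  exact hL s hs

/-- The infimum of the empty set is 0 by convention. Generation by reflections is not proved, so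
this default has to be excluded in the comparison with `IsDual`. -/
theorem wordLength_of_not_isReflectionProd {n : ℕ} {w : WA (2 * n)} (hw : ¬ IsReflectionProd w) :
    wordLength (reflections (2 * n)) w = 0 := by
  refine Nat.sInf_eq_zero.2 (Or.inr (Set.eq_empty_iff_forall_notMem.2 ?_))
  rintro k ⟨L, h1, h2, -⟩
  exact hw ⟨L, h1, h2⟩

/-! ### Dual elements: factors and shortening by reflections -/

section Dual

variable {n : ℕ} [NeZero (2 * n)]

theorem isDual_coxeterC : IsDual (coxeterC n) := by
  unfold IsDual
  rw [invDim_coxeterC, inv_mul_cancel, invDim_one, zero_add]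

/-- Subadditivity for `u⁻¹ c = v ((uv)⁻¹ c)` and for `v⁻¹ c = ((uv)⁻¹ c) (c⁻¹ u c)` bounds the
codimension of each complement from above; subadditivity for `c = u (u⁻¹ c) = v (v⁻¹ c)` bounds it
from below by the same number. -/
theorem isDual_of_mul {u v : WA (2 * n)} (h : IsDual (u * v))
    (hk : invDim u + invDim v = 2 * n + invDim (u * v)) : IsDual u ∧ IsDual v := by
  unfold IsDual at *
  have e1 : u⁻¹ * coxeterC n = v * ((u * v)⁻¹ * coxeterC n) := by group
  have e2 : v⁻¹ * coxeterC n = ((u * v)⁻¹ * coxeterC n) * ((coxeterC n)⁻¹ * u * coxeterC n) := by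
    group
  have a1 := invDim_mul v ((u * v)⁻¹ * coxeterC n)
  have a2 := invDim_mul ((u * v)⁻¹ * coxeterC n) ((coxeterC n)⁻¹ * u * coxeterC n)
  have b1 := invDim_mul u (u⁻¹ * coxeterC n)
  have b2 := invDim_mul v (v⁻¹ * coxeterC n)
  rw [← e1] at a1
  rw [← e2, invDim_conj] at a2
  rw [mul_inv_cancel_left, invDim_coxeterC] at b1 b2
  omega

theorem IsDual.complement {u : WA (2 * n)} (h : IsDual u) : IsDual (u⁻¹ * coxeterC n) := by
  refine (isDual_of_mul (u := u) (by rw [mul_inv_cancel_left]; exact isDual_coxeterC) ?_).2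
  rw [mul_inv_cancel_left, invDim_coxeterC]
  exact h

/-- A nontrivial dual element can be shortened by a reflection. -/
theorem IsDual.exists_reflection {w : WA (2 * n)} (hw : IsDual w) (h1 : w ≠ 1) :
    ∃ t ∈ reflections (2 * n), invDim w < invDim (t * w) := by
  have hsd := ((isDual_iff w).1 hw).1
  -- If `w` changes the class of `x`, the reflection `(x, w x)` turns `x` into a fixed point, which
  -- carries a new invariant function.
  by_cases hx : ∃ x, ¬ x ≡ w.1 x [ZMOD ((2 * n : ℕ) : ℤ)]
  · obtain ⟨x, hx⟩ := hx
    obtain ⟨t, htr, ht⟩ := exists_isTransposition hx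
    have htx : ∀ j : ℤ, t.1 (w.1 (x + j * ((2 * n : ℕ) : ℤ))) = x + j * ((2 * n : ℕ) : ℤ) := by
      intro j
      rw [w.2.1.add_mul, (ht.1 j).2]
    refine ⟨t, htr, invDim_lt_of_mul ht (fun f hf => (mem_invariants.1 hf x).symm)
      (f := twistedSingle (2 * n) x) (mem_invariants.2 fun z => ?_) fun hf => ?_⟩
    · change (twistedSingle (2 * n) x).1 (t.1 (w.1 z)) = _
      by_cases hz : z ≡ x [ZMOD ((2 * n : ℕ) : ℤ)]
      · obtain ⟨j, rfl⟩ := hz.exists_eq_add_mul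
        rw [htx]
      · rw [twistedSingle_of_not_modEq hz, twistedSingle_of_not_modEq]
        intro h
        obtain ⟨j, hj⟩ := h.exists_eq_add_mul
        rw [← htx j] at hj
        rw [w.1.injective (t.1.injective hj)] at hz
        exact hz (Int.add_mul_modEq _ _ _)
    · have := mem_invariants.1 hf x
      rw [twistedSingle_self, twistedSingle_of_not_modEq (fun h => hx h.symm)] at this
      norm_num at this
  -- Now `w` translates each class. Moved points have infinite orbits, hence are ascents: odd ones
  -- move right, even ones move left. Total shift zero forces both kinds to occur.
  push Not at hx
  have hx' : ∀ x, ∃ j : ℤ, w.1 x = x + j * ((2 * n : ℕ) : ℤ) := fun x =>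
    (hx x).symm.exists_eq_add_mul
  have hzero : ∀ x, w.1 x ≠ x → ∀ f ∈ invariants w, f.1 x = 0 := by
    intro x hne f hf
    obtain ⟨j, hj⟩ := hx' x
    refine invariants_eq_zero hf (i := 1) (s := j) (by simpa using hj) ?_
    rintro rfl
    exact hne (by simpa using hj)
  have hasc : ∀ x, w.1 x ≠ x → stripKey x < stripKey (w.1 x) := by
    intro x hne
    by_contra hc
    obtain ⟨f, hf, e, -⟩ := hsd x (not_lt.1 hc)
    rw [hzero x hne f hf] at e
    norm_num at e
  have hpar : ∀ x, w.1 x % 2 = x % 2 := fun x => by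
    obtain ⟨j, hj⟩ := hx' x
    rw [hj, add_mul_emod_two]
  have hNpos : (0 : ℤ) < ((2 * n : ℕ) : ℤ) := Int.natCast_pos.2 (NeZero.pos _)
  obtain ⟨x, hxodd, hxne⟩ : ∃ x, x % 2 = 1 ∧ w.1 x ≠ x := by
    by_contra! hc
    refine h1 (eq_one_of_apply_le fun x => ?_)
    by_contra hlt
    have h2 := hasc x (by omega)
    have h3 := hpar x
    have h4 := hc x
    rw [stripKey_lt_iff] at h2
    omega
  obtain ⟨y, hyeven, hyne⟩ : ∃ y, y % 2 = 0 ∧ w.1 y ≠ y := by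
    by_contra! hc
    refine h1 (eq_one_of_le_apply fun x => ?_)
    by_contra hlt
    have h2 := hasc x (by omega)
    have h3 := hpar x
    have h4 := hc x
    rw [stripKey_lt_iff] at h2
    omega
  have hwx : w.1 x = x + 1 * ((2 * n : ℕ) : ℤ) := by
    obtain ⟨j, hj⟩ := hx' x
    have h2 := hasc x hxne
    have h3 := hpar x
    rw [stripKey_lt_iff] at h2
    have hj1 : 1 ≤ j := by
      by_contra hc
      have : j * ((2 * n : ℕ) : ℤ) ≤ 0 := mul_nonpos_of_nonpos_of_nonneg (by omega) hNpos.le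
      omega
    -- A longer translation would make the ascents of `x` and `x + 2n` cross.
    have hj2 : ¬ 2 ≤ j := fun hc => by
      have h4 : 2 * ((2 * n : ℕ) : ℤ) ≤ j * ((2 * n : ℕ) : ℤ) :=
        mul_le_mul_of_nonneg_right hc hNpos.le
      have h5 : w.1 (x + ((2 * n : ℕ) : ℤ)) = w.1 x + ((2 * n : ℕ) : ℤ) := w.2.1 x
      refine hw.not_crossing (v := x) (x := x + ((2 * n : ℕ) : ℤ)) ?_ ?_ ?_
      all_goals rw [stripKey_lt_iff]; omega
    rw [hj, show j = 1 by omega]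
  have hwy : w.1 y = y + (-1) * ((2 * n : ℕ) : ℤ) := by
    obtain ⟨j, hj⟩ := hx' y
    have h2 := hasc y hyne
    have h3 := hpar y
    rw [stripKey_lt_iff] at h2
    have hj1 : j ≤ -1 := by
      by_contra hc
      have : 0 ≤ j * ((2 * n : ℕ) : ℤ) := mul_nonneg (by omega) hNpos.le
      omega
    have hj2 : ¬ j ≤ -2 := fun hc => by
      have h4 : j * ((2 * n : ℕ) : ℤ) ≤ (-2) * ((2 * n : ℕ) : ℤ) :=
        mul_le_mul_of_nonneg_right hc hNpos.le
      have h5 : w.1 (y + (-1) * ((2 * n : ℕ) : ℤ)) = w.1 y + (-1) * ((2 * n : ℕ) : ℤ) :=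
        w.2.1.add_mul y (-1)
      refine hw.not_crossing (v := y) (x := y + (-1) * ((2 * n : ℕ) : ℤ)) ?_ ?_ ?_
      all_goals rw [stripKey_lt_iff]; omega
    rw [hj, show j = -1 by omega]
  have hxy : ¬ x ≡ y [ZMOD ((2 * n : ℕ) : ℤ)] := fun h => by
    obtain ⟨j, hj⟩ := h.exists_eq_add_mul
    have := add_mul_emod_two n y j
    rw [← hj] at this
    omega
  obtain ⟨t, htr, ht⟩ := exists_isTransposition hxy
  -- The product `t w` sends `x` to `y + 2n` and `y + 2n` back to `x`, merging two infinite orbits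
  -- into a finite one. The factor `2⁻¹` makes `f` equal at `x` and `y + 2n`.
  set f : Twisted (2 * n) :=
    twistedSingle (2 * n) x + (2⁻¹ : ℚ) • twistedSingle (2 * n) y with hfdef
  have hfv : ∀ z, f.1 z = (twistedSingle (2 * n) x).1 z + 2⁻¹ * (twistedSingle (2 * n) y).1 z :=
    fun z => rfl
  have hfx : ∀ j : ℤ, f.1 (x + j * ((2 * n : ℕ) : ℤ)) = 2 ^ j := fun j => by
    rw [hfv, twistedSingle_add_mul, twistedSingle_of_not_modEq, mul_zero, add_zero]
    exact fun h => hxy ((Int.add_mul_modEq _ _ _).symm.trans h)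
  have hfy : ∀ j : ℤ, f.1 (y + j * ((2 * n : ℕ) : ℤ)) = 2 ^ (j - 1) := fun j => by
    rw [hfv, twistedSingle_add_mul, twistedSingle_of_not_modEq,
      zpow_sub₀ (by norm_num : (2 : ℚ) ≠ 0)]
    · ring
    · exact fun h => hxy (h.symm.trans (Int.add_mul_modEq _ _ _))
  refine ⟨t, htr, invDim_lt_of_mul ht (fun f hf => by rw [hzero x hxne f hf, hzero y hyne f hf])
    (f := f) (mem_invariants.2 fun z => ?_) fun hf => ?_⟩
  · change f.1 (t.1 (w.1 z)) = _
    by_cases hzx : z ≡ x [ZMOD ((2 * n : ℕ) : ℤ)]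
    · obtain ⟨j, rfl⟩ := hzx.exists_eq_add_mul
      rw [w.2.1.add_mul, hwx, add_assoc, ← add_mul, (ht.1 _).1, hfx, hfy]
      congr 1
      ring
    by_cases hzy : z ≡ y [ZMOD ((2 * n : ℕ) : ℤ)]
    · obtain ⟨j, rfl⟩ := hzy.exists_eq_add_mul
      rw [w.2.1.add_mul, hwy, add_assoc, ← add_mul, (ht.1 _).2, hfx, hfy]
      congr 1
      ring
    have hwz := (hx z).symm
    rw [ht.2 _ (fun h => hzx (hwz.symm.trans h)) (fun h => hzy (hwz.symm.trans h)), hfv, hfv,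
      twistedSingle_of_not_modEq hzx, twistedSingle_of_not_modEq hzy,
      twistedSingle_of_not_modEq (fun h => hzx (hwz.symm.trans h)),
      twistedSingle_of_not_modEq (fun h => hzy (hwz.symm.trans h))]
  · have h2 := hzero x hxne f hf
    have h3 := hfx 0
    rw [zero_mul, add_zero, h2] at h3
    norm_num at h3

/-! ## Lengths -/

theorem invDim_list_prod (L : List (WA (2 * n))) (hL : ∀ t ∈ L, t ∈ reflections (2 * n)) :
    2 * n ≤ invDim L.prod + L.length := by
  induction L with
  | nil => simp [invDim_one]
  | cons t L ih =>
    have h1 := ih fun s hs => hL s (List.mem_cons_of_mem _ hs)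
    have h2 := invDim_reflection (hL t List.mem_cons_self)
    have h3 := invDim_mul t L.prod
    rw [List.prod_cons, List.length_cons]
    omega

theorem IsReflectionProd.le_wordLength {w : WA (2 * n)} (hw : IsReflectionProd w) :
    2 * n ≤ invDim w + wordLength (reflections (2 * n)) w := by
  obtain ⟨L, hL, h⟩ := hw
  obtain ⟨M, h1, h2, h3⟩ := Nat.sInf_mem (s := {k | ∃ L : List (WA (2 * n)),
    (∀ s ∈ L, s ∈ reflections (2 * n)) ∧ L.prod = w ∧ L.length = k}) ⟨_, L, hL, h, rfl⟩
  have := invDim_list_prod M h1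
  rw [h2, h3] at this
  exact this

/-- Induction on the codimension: the reflection that shortens `w` lowers it by exactly 1, so
codimensions add in `w = t (t w)` and `t w` is dual again. -/
theorem IsDual.exists_list {w : WA (2 * n)} (hw : IsDual w) : ∃ L : List (WA (2 * n)),
    (∀ t ∈ L, t ∈ reflections (2 * n)) ∧ L.prod = w ∧ L.length + invDim w = 2 * n := by
  have hle := invDim_le w
  generalize hm : 2 * n - invDim w = m
  induction m generalizing w with
  | zero =>
    have : invDim w = 2 * n := by omega
    exact ⟨[], by simp, by simp [eq_one_of_invDim_eq this], by simp [this]⟩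
  | succ m ih =>
    obtain ⟨t, ht, hlt⟩ := hw.exists_reflection (by rintro rfl; rw [invDim_one] at hm; omega)
    have htt : t * (t * w) = w := by rw [← mul_assoc, mul_self_of_mem_reflections ht, one_mul]
    have h1 := invDim_mul t (t * w)
    have h2 := invDim_reflection ht
    have h3 := invDim_le (t * w)
    have h5 := invDim_le t
    have h6 : invDim t ≠ 2 * n := fun h => by
      rw [eq_one_of_invDim_eq h, one_mul] at hlt
      omega
    rw [htt] at h1
    have h4 : IsDual (t * w) := (isDual_of_mul (u := t) (by rwa [htt]) (by rw [htt]; omega)).2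
    obtain ⟨L, a, b, c⟩ := ih h4 h3 (by omega)
    refine ⟨t :: L, ?_, by rw [List.prod_cons, b, htt], by rw [List.length_cons]; omega⟩
    intro s hs
    rcases List.mem_cons.1 hs with rfl | hs
    · exact ht
    · exact a s hs

theorem IsDual.isReflectionProd {w : WA (2 * n)} (hw : IsDual w) : IsReflectionProd w := by
  obtain ⟨L, a, b, -⟩ := hw.exists_list
  exact ⟨L, a, b⟩

theorem IsDual.wordLength_add {w : WA (2 * n)} (hw : IsDual w) :
    wordLength (reflections (2 * n)) w + invDim w = 2 * n := by
  have h1 := hw.isReflectionProd.le_wordLength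
  obtain ⟨L, a, b, c⟩ := hw.exists_list
  have h2 : wordLength (reflections (2 * n)) w ≤ L.length := Nat.sInf_le ⟨L, a, b, rfl⟩
  omega

/-- Length is at least codimension on products of reflections, with equality on dual elements. If
`w` were not such a product, neither would be `w⁻¹ c`, and both lengths would be 0 while that of `c`
is `2n > 0`. -/
theorem lenDvd_coxeterC_iff {w : WA (2 * n)} :
    LenDvd (reflections (2 * n)) w (coxeterC n) ↔ IsDual w := by
  have hc := (isDual_coxeterC (n := n)).wordLength_add
  have hcg := (isDual_coxeterC (n := n)).isReflectionProd
  rw [invDim_coxeterC] at hc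
  have hpos := NeZero.pos (2 * n)
  constructor
  · intro h
    unfold LenDvd at h
    have hiff : IsReflectionProd w ↔ IsReflectionProd (w⁻¹ * coxeterC n) := by
      refine ⟨fun hw => hw.inv.mul hcg, fun hw => ?_⟩
      have := hcg.mul hw.inv
      rwa [mul_inv_rev, inv_inv, mul_inv_cancel_left] at this
    by_cases hw : IsReflectionProd w
    · have h1 := hw.le_wordLength
      have h2 := (hiff.1 hw).le_wordLength
      have h3 := invDim_mul w (w⁻¹ * coxeterC n)
      rw [mul_inv_cancel_left, invDim_coxeterC] at h3
      unfold IsDual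
      omega
    · rw [wordLength_of_not_isReflectionProd hw,
        wordLength_of_not_isReflectionProd fun h => hw (hiff.2 h)] at h
      omega
  · intro h
    have h1 := h.wordLength_add
    have h2 := h.complement.wordLength_add
    unfold IsDual at h
    unfold LenDvd
    omega

end Dual

/-! ## The partition attached to a dual element -/

/-- The points `x` and `y` are not separated by the invariant functions of `w`: they are in
the same finite orbit, or both are in infinite orbits. -/
def Agree {N : ℕ} (w : WA N) (x y : ℤ) : Prop := ∀ f ∈ invariants w, f.1 x = f.1 y

/-- Periodic symmetric non-crossing partitions of the boundary of the strip in which all the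
classes which meet one of their translates are equal. -/
structure IsNoncrossing (n : ℕ) (R : ℤ → ℤ → Prop) : Prop where
  equivalence : Equivalence R
  add_mul : ∀ {x y : ℤ} (j : ℤ), R x y →
    R (x + j * ((2 * n : ℕ) : ℤ)) (y + j * ((2 * n : ℕ) : ℤ))
  one_sub : ∀ {x y : ℤ}, R x y → R (1 - x) (1 - y)
  noncrossing : ∀ {x u y v : ℤ}, stripKey x < stripKey u → stripKey u < stripKey y →
    stripKey y < stripKey v → R x y → R u v → R x u
  translated : ∀ {x y i j : ℤ}, R x (x + i * ((2 * n : ℕ) : ℤ)) → i ≠ 0 →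
    R y (y + j * ((2 * n : ℕ) : ℤ)) → j ≠ 0 → R x y

theorem Agree.apply {N : ℕ} (w : WA N) (x : ℤ) : Agree w x (w.1 x) := fun _ hf =>
  (mem_invariants.1 hf x).symm

theorem Agree.pow {N : ℕ} (w : WA N) (x : ℤ) (i : ℕ) : Agree w x ((w.1 ^ i) x) := fun _ hf =>
  (invariants_pow hf i x).symm

theorem Agree.symm {N : ℕ} {w : WA N} {x y : ℤ} (h : Agree w x y) : Agree w y x := fun f hf =>
  (h f hf).symm

theorem Agree.trans {N : ℕ} {w : WA N} {x y z : ℤ} (h : Agree w x y) (h' : Agree w y z) :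
    Agree w x z := fun f hf => (h f hf).trans (h' f hf)

theorem invariants_le_iff_agree {N : ℕ} {v w : WA N} :
    invariants w ≤ invariants v ↔ ∀ x y, Agree v x y → Agree w x y := by
  constructor
  · intro h x y hxy f hf
    exact hxy f (h hf)
  · intro h f hf
    exact mem_invariants.2 fun x => (h _ _ (Agree.apply v x) f hf).symm

theorem pow_mul_apply {N : ℕ} {w : WA N} {x s : ℤ} {i : ℕ} (h : (w.1 ^ i) x = x + s * N) (k : ℕ) :
    (w.1 ^ (i * k)) x = x + (k * s) * N := by
  induction k with
  | zero => simp
  | succ k ih =>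
    have hp : IsPeriodic N (w.1 ^ i) := ((WA N).pow_mem w.2 i).1
    rw [Nat.mul_succ, add_comm, pow_add, Equiv.Perm.mul_apply, ih, hp.add_mul, h]
    push_cast
    ring

theorem apply_one_sub {N : ℕ} {w : WA N} (hw : sigmaW N w = w) (x : ℤ) :
    w.1 (1 - x) = 1 - w.1 x := by
  have h : 1 - w.1 (1 - x) = w.1 x := by
    conv_rhs => rw [← hw]
    rfl
  linarith

theorem pow_one_sub {N : ℕ} {w : WA N} (hw : sigmaW N w = w) (i : ℕ) (x : ℤ) :
    (w.1 ^ i) (1 - x) = 1 - (w.1 ^ i) x := by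
  induction i with
  | zero => simp
  | succ i ih => rw [pow_succ', Equiv.Perm.mul_apply, ih, apply_one_sub hw, Equiv.Perm.mul_apply]

theorem SeparatesDescents.not_isDescent {n : ℕ} {w : WA (2 * n)} (hw : SeparatesDescents w) {x : ℤ}
    (hx : ∀ f ∈ invariants w, f.1 x = 0) (m : ℕ) : ¬ IsDescent w.1 ((w.1 ^ m) x) := fun h => by
  obtain ⟨f, hf, e, -⟩ := hw _ h
  rw [invariants_pow hf, hx f hf] at e
  norm_num at e

theorem SeparatesDescents.eq_of_agree {n : ℕ} {w : WA (2 * n)} (hw : SeparatesDescents w) {d d' : ℤ}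
    (hd : IsDescent w.1 d) (hd' : IsDescent w.1 d') (h : Agree w d d') : d' = d := by
  obtain ⟨f, hf, e, e'⟩ := hw d hd
  have h1 := h f hf
  by_cases hm : d' ≡ d [ZMOD ((2 * n : ℕ) : ℤ)]
  · obtain ⟨j, rfl⟩ := hm.exists_eq_add_mul
    rw [twisted_apply_add_mul, e, mul_one] at h1
    rw [two_zpow_eq_one h1.symm]
    simp
  · rw [e' d' hd' hm, e] at h1
    norm_num at h1

/-! ### Classes of a dual element are non-crossing -/

section Partition

variable {n : ℕ} [NeZero (2 * n)]

theorem exists_isDescent_of_ne_zero {w : WA (2 * n)} {f : Twisted (2 * n)} (hf : f ∈ invariants w)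
    {x : ℤ} (hx : f.1 x ≠ 0) : ∃ m : ℕ, IsDescent w.1 ((w.1 ^ m) x) := by
  obtain ⟨i, hi, s, hs⟩ := exists_pow_eq_add_mul w x
  by_cases h0 : s = 0
  · rw [h0, zero_mul, add_zero] at hs
    exact exists_isDescent_of_pow_eq hi hs
  · exact absurd (invariants_eq_zero hf hs h0) hx

/-- In a finite class, one goes up from one point to another one by iterating `w`. -/
theorem SeparatesDescents.exists_pow_of_lt {w : WA (2 * n)} (hw : SeparatesDescents w) {p q : ℤ}
    (h : Agree w p q) (hp : ∃ f ∈ invariants w, f.1 p ≠ 0) (hpq : stripKey p < stripKey q) :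
    ∃ k, (w.1 ^ k) p = q ∧ ∀ i < k, stripKey ((w.1 ^ i) p) < stripKey ((w.1 ^ (i + 1)) p) := by
  classical
  obtain ⟨f, hf, hfp⟩ := hp
  have hm := exists_isDescent_of_ne_zero hf hfp
  have hm' := exists_isDescent_of_ne_zero hf (x := q) (by rwa [← h f hf])
  have key : ∀ (x : ℤ) (hx : ∃ m : ℕ, IsDescent w.1 ((w.1 ^ m) x)), ∀ i < Nat.find hx,
      stripKey ((w.1 ^ i) x) < stripKey ((w.1 ^ (i + 1)) x) := fun x hx i hi => by
    have := Nat.find_min hx hi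
    unfold IsDescent at this
    rwa [not_le, ← Equiv.Perm.mul_apply, ← pow_succ'] at this
  have hd : (w.1 ^ (Nat.find hm')) q = (w.1 ^ (Nat.find hm)) p :=
    hw.eq_of_agree (Nat.find_spec hm) (Nat.find_spec hm')
      (((Agree.pow w p _).symm.trans h).trans (Agree.pow w q _))
  rcases le_or_gt (Nat.find hm') (Nat.find hm) with hle | hlt
  · obtain ⟨k, hk⟩ := Nat.exists_eq_add_of_le hle
    rw [hk, pow_add, Equiv.Perm.mul_apply] at hd
    exact ⟨k, ((w.1 ^ _).injective hd).symm, fun i hi => key p hm i (by omega)⟩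
  · obtain ⟨k, hk⟩ := Nat.exists_eq_add_of_lt hlt
    rw [hk, add_assoc, pow_add, Equiv.Perm.mul_apply] at hd
    have h1 := (exists_step (fun i => stripKey ((w.1 ^ i) q)) (k + 1)
      fun i hi => key q hm' i (by omega)).1
    simp only [(w.1 ^ _).injective hd, pow_zero, Equiv.Perm.one_apply] at h1
    exact absurd hpq (not_lt.2 h1)

/-- The iterates of `w` climb from `p` to `q` and avoid `g`, so one step passes strictly over it.
This reduces crossings of classes to crossings of ascents. -/
theorem SeparatesDescents.exists_arc_of_agree {w : WA (2 * n)} (hw : SeparatesDescents w)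
    {p q g : ℤ} (h : Agree w p q) (hp : ∃ f ∈ invariants w, f.1 p ≠ 0)
    (h1 : stripKey p < stripKey g) (h2 : stripKey g < stripKey q) (hg : ¬ Agree w p g) :
    ∃ r, Agree w p r ∧ stripKey p ≤ stripKey r ∧ stripKey r < stripKey g ∧
      stripKey g < stripKey (w.1 r) ∧ stripKey (w.1 r) ≤ stripKey q := by
  obtain ⟨k, hk, hlt⟩ := hw.exists_pow_of_lt h hp (h1.trans h2)
  obtain ⟨i, -, a, b, c, d⟩ := (exists_step (fun i => stripKey ((w.1 ^ i) p)) k hlt).2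
    (stripKey g) (by simpa using h1) (by rw [hk]; exact h2.le)
  have e : (w.1 ^ (i + 1)) p = w.1 ((w.1 ^ i) p) := by rw [pow_succ', Equiv.Perm.mul_apply]
  rw [e] at c d
  refine ⟨(w.1 ^ i) p, Agree.pow w p i, by simpa using a, b, lt_of_le_of_ne c fun he => hg ?_,
    by rwa [hk] at d⟩
  rw [stripKey_injective he, ← e]
  exact Agree.pow w p _

/-- An infinite orbit has no point under an ascent of a finite orbit. -/
theorem IsDual.not_between {w : WA (2 * n)} (hw : IsDual w) {p g : ℤ}
    (hp : ∃ f ∈ invariants w, f.1 p ≠ 0) (hg : ∀ f ∈ invariants w, f.1 g = 0)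
    (h1 : stripKey p < stripKey g) (h2 : stripKey g < stripKey (w.1 p)) : False := by
  have hsd := ((isDual_iff w).1 hw).1
  have hasc : ∀ x, (∀ f ∈ invariants w, f.1 x = 0) → ∀ m : ℕ,
      stripKey ((w.1 ^ m) x) < stripKey ((w.1 ^ (m + 1)) x) := fun x hx m => by
    have := hsd.not_isDescent hx m
    unfold IsDescent at this
    rwa [not_le, ← Equiv.Perm.mul_apply, ← pow_succ'] at this
  obtain ⟨i, hi, s, hs⟩ := exists_pow_eq_add_mul w g
  have hlt : stripKey g < stripKey (g + s * ((2 * n : ℕ) : ℤ)) := by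
    obtain ⟨j, rfl⟩ : ∃ j, i = j + 1 := ⟨i - 1, by omega⟩
    have h3 := (exists_step (fun m => stripKey ((w.1 ^ m) g)) j fun m _ => hasc g hg m).1
    have h4 := hasc g hg j
    rw [hs] at h4
    exact lt_of_le_of_lt (by simpa using h3) h4
  have hpar := fun k : ℤ => add_mul_emod_two n g k
  have hpar1 := hpar s
  rw [stripKey_lt_iff] at hlt
  set S := s * ((2 * n : ℕ) : ℤ) with hS
  have hpow : ∀ k : ℕ, (w.1 ^ (i * k)) g = g + k * S := fun k => by
    rw [pow_mul_apply hs, hS, mul_assoc]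
  -- The orbit of `g` climbs through translates of `g`. If `g` and `w p` have the same parity it
  -- eventually passes `w p`, and the step over `w p` crosses the ascent of `p`.
  by_cases hcase : g % 2 = (w.1 p) % 2
  · obtain ⟨k, hk⟩ : ∃ k : ℕ, stripKey (w.1 p) ≤ stripKey (g + k * S) := by
      rcases Int.emod_two_eq_zero_or_one g with h0 | h0
      · refine ⟨(g - w.1 p).toNat, ?_⟩
        have h3 := hpar ((g - w.1 p).toNat * s)
        rw [mul_assoc, ← hS] at h3
        have h4 : ((g - w.1 p).toNat : ℤ) * S ≤ ((g - w.1 p).toNat : ℤ) * (-1) :=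
          mul_le_mul_of_nonneg_left (by omega) (by omega)
        rw [stripKey_le_iff]
        omega
      · refine ⟨(w.1 p - g).toNat, ?_⟩
        have h3 := hpar ((w.1 p - g).toNat * s)
        rw [mul_assoc, ← hS] at h3
        have h4 : ((w.1 p - g).toNat : ℤ) * 1 ≤ ((w.1 p - g).toNat : ℤ) * S :=
          mul_le_mul_of_nonneg_left (by omega) (by omega)
        rw [stripKey_le_iff]
        omega
    obtain ⟨m, -, a, b, c, -⟩ := (exists_step (fun m => stripKey ((w.1 ^ m) g)) (i * k)
      fun m _ => hasc g hg m).2 (stripKey (w.1 p)) (by simpa using h2) (by rwa [hpow])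
    rw [pow_succ', Equiv.Perm.mul_apply] at c
    rw [pow_zero, Equiv.Perm.one_apply] at a
    refine hw.not_crossing (h1.trans_le a) b (lt_of_le_of_ne c fun he => ?_)
    rw [← w.1.injective (stripKey_injective he)] at a
    exact absurd h1 (not_lt.2 a)
  · rw [stripKey_lt_iff] at h1 h2
    -- Here `p` and `g` are odd and `w p` is even, so the orbit may never pass `w p`. Going back
    -- along it to a translate of `g` below `p` gives a step over `p` ending at or before `g`, which
    -- crosses the ascent of `p`.
    have hk : stripKey (g + ((-(g - p + 1).toNat : ℤ)) * S) < stripKey p := by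
      have h3 := hpar (-(g - p + 1).toNat * s)
      rw [mul_assoc, ← hS] at h3
      have h4 : (-(g - p + 1).toNat : ℤ) * S ≤ (-(g - p + 1).toNat : ℤ) * 1 :=
        mul_le_mul_of_nonpos_left (by omega) (by omega)
      rw [stripKey_lt_iff]
      omega
    set k := (g - p + 1).toNat with hkdef
    set y := g + (-(k : ℤ)) * S with hy
    have hyg : (w.1 ^ (i * k)) y = g := by
      have hp : IsPeriodic (2 * n) (w.1 ^ (i * k)) := ((WA (2 * n)).pow_mem w.2 _).1
      rw [hy, hS, ← mul_assoc, hp.add_mul, hpow, hS]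
      ring
    have hyz : ∀ f ∈ invariants w, f.1 y = 0 := fun f hf => by
      rw [← invariants_pow hf (i * k), hyg, hg f hf]
    obtain ⟨m, -, a, b, c, d⟩ := (exists_step (fun m => stripKey ((w.1 ^ m) y)) (i * k)
      fun m _ => hasc y hyz m).2 (stripKey p) (by simpa using hk)
      (by rw [hyg, stripKey_le_iff]; omega)
    rw [hyg] at d
    have hne : stripKey p ≠ stripKey ((w.1 ^ (m + 1)) y) := fun he => by
      obtain ⟨f, hf, hfp⟩ := hp
      rw [stripKey_injective he, invariants_pow hf] at hfp
      exact hfp (hyz f hf)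
    have c := lt_of_le_of_ne c hne
    rw [pow_succ', Equiv.Perm.mul_apply] at c d
    exact hw.not_crossing b c (lt_of_le_of_lt d (stripKey_lt_iff.2 h2))

theorem IsDual.agree_noncrossing {w : WA (2 * n)} (hw : IsDual w) {x u y v : ℤ}
    (h1 : stripKey x < stripKey u) (h2 : stripKey u < stripKey y)
    (h3 : stripKey y < stripKey v) (hxy : Agree w x y) (huv : Agree w u v) : Agree w x u := by
  have hsd := ((isDual_iff w).1 hw).1
  by_contra hne
  by_cases hx : ∃ f ∈ invariants w, f.1 x ≠ 0
  · obtain ⟨r, hr, a, b, c, d⟩ := hsd.exists_arc_of_agree hxy hx h1 h2 hne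
    have hur : ¬ Agree w u (w.1 r) := fun h =>
      hne ((hr.trans (Agree.apply w r)).trans h.symm)
    by_cases hu : ∃ f ∈ invariants w, f.1 u ≠ 0
    · obtain ⟨r', hr', a', b', c', d'⟩ := hsd.exists_arc_of_agree huv hu c (d.trans_lt h3) hur
      exact hw.not_crossing (b.trans_le a') b' c'
    · push Not at hu
      obtain ⟨f, hf, hfx⟩ := hx
      exact hw.not_between ⟨f, hf, by rwa [← hr f hf]⟩ hu b c
  · push Not at hx
    by_cases hu : ∃ f ∈ invariants w, f.1 u ≠ 0
    · have hy : ∀ f ∈ invariants w, f.1 y = 0 := fun f hf => by rw [← hxy f hf, hx f hf]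
      obtain ⟨r, hr, a, b, c, d⟩ := hsd.exists_arc_of_agree huv hu h2 h3
        (fun h => hne (hxy.trans h.symm))
      obtain ⟨f, hf, hfu⟩ := hu
      exact hw.not_between ⟨f, hf, by rwa [← hr f hf]⟩ hy b c
    · push Not at hu
      exact hne fun f hf => by rw [hx f hf, hu f hf]

/-- Invariance by `σ` is used only for symmetry: `w` commutes with `x ↦ 1 - x`, which therefore
carries finite orbits to finite ones and infinite orbits to infinite ones. -/
theorem IsDual.isNoncrossing_agree {w : WA (2 * n)} (hw : IsDual w)
    (hs : sigmaW (2 * n) w = w) : IsNoncrossing n (Agree w) where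
  equivalence := ⟨fun _ _ _ => rfl, Agree.symm, Agree.trans⟩
  add_mul j h f hf := by rw [twisted_apply_add_mul, twisted_apply_add_mul, h f hf]
  one_sub {x y} h := by
    have hsd := ((isDual_iff w).1 hw).1
    by_cases hx : ∃ f ∈ invariants w, f.1 x ≠ 0
    · obtain ⟨f, hf, hfx⟩ := hx
      obtain ⟨m, hm⟩ := exists_isDescent_of_ne_zero hf hfx
      obtain ⟨m', hm'⟩ := exists_isDescent_of_ne_zero hf (x := y) (by rwa [← h f hf])
      have he := hsd.eq_of_agree hm hm'
        (((Agree.pow w x m).symm.trans h).trans (Agree.pow w y m'))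
      intro f hf
      rw [← invariants_pow hf m, ← invariants_pow hf m' (1 - y), pow_one_sub hs, pow_one_sub hs, he]
    · push Not at hx
      have key : ∀ x, (∀ f ∈ invariants w, f.1 x = 0) → ∀ f ∈ invariants w, f.1 (1 - x) = 0 := by
        intro x hx f hf
        obtain ⟨i, hi, s, hs'⟩ := exists_pow_eq_add_mul w x
        by_cases h0 : s = 0
        · rw [h0, zero_mul, add_zero] at hs'
          obtain ⟨m, hm⟩ := exists_isDescent_of_pow_eq hi hs'
          exact absurd hm (hsd.not_isDescent hx m)
        · refine invariants_eq_zero hf (i := i) (s := -s) ?_ (neg_ne_zero.2 h0)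
          rw [pow_one_sub hs, hs']
          ring
      intro f hf
      rw [key x hx f hf, key y (fun f hf => by rw [← h f hf, hx f hf]) f hf]
  noncrossing := hw.agree_noncrossing
  translated {x y i j} hx hi hy hj f hf := by
    have key : ∀ {x i : ℤ}, Agree w x (x + i * ((2 * n : ℕ) : ℤ)) → i ≠ 0 → f.1 x = 0 := by
      intro x i hx hi
      have h := hx f hf
      rw [twisted_apply_add_mul] at h
      by_contra h2
      exact hi (two_zpow_eq_one (mul_right_cancel₀ h2 (h.symm.trans (one_mul _).symm)))
    rw [key hx hi, key hy hj]

end Partition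

/-! ## The dual element attached to a non-crossing partition -/

/-- `y` follows `x` cyclically in the class of `x`. -/
def IsNext (R : ℤ → ℤ → Prop) (x y : ℤ) : Prop :=
  R x y ∧ ((stripKey x < stripKey y ∧ ∀ z, R x z → stripKey x < stripKey z →
      stripKey y ≤ stripKey z) ∨
    (stripKey y ≤ stripKey x ∧ ∀ z, R x z → stripKey z ≤ stripKey x ∧ stripKey y ≤ stripKey z))

theorem IsNext.right_unique {R : ℤ → ℤ → Prop} {x y y' : ℤ} (h : IsNext R x y)
    (h' : IsNext R x y') : y = y' := by
  obtain ⟨r, ⟨a, b⟩ | ⟨a, b⟩⟩ := h <;> obtain ⟨r', ⟨a', b'⟩ | ⟨a', b'⟩⟩ := h'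
  · exact stripKey_injective (le_antisymm (b y' r' a') (b' y r a))
  · exact absurd a (not_lt.2 (b' y r).1)
  · exact absurd a' (not_lt.2 (b y' r').1)
  · exact stripKey_injective (le_antisymm (b y' r').2 (b' y r).2)

theorem IsNext.left_unique {R : ℤ → ℤ → Prop} (hR : Equivalence R) {x x' y : ℤ}
    (h : IsNext R x y) (h' : IsNext R x' y) : x = x' := by
  have hxx' : R x x' := hR.trans h.1 (hR.symm h'.1)
  have hx'x := hR.symm hxx'
  obtain ⟨r, ⟨a, b⟩ | ⟨a, b⟩⟩ := h <;> obtain ⟨r', ⟨a', b'⟩ | ⟨a', b'⟩⟩ := h'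
  · apply stripKey_injective
    refine le_antisymm (not_lt.1 fun hc => ?_) (not_lt.1 fun hc => ?_)
    · exact absurd a (not_lt.2 (b' x hx'x hc))
    · exact absurd a' (not_lt.2 (b x' hxx' hc))
  · exact absurd a (not_lt.2 (b' x hx'x).2)
  · exact absurd a' (not_lt.2 (b x' hxx').2)
  · exact stripKey_injective (le_antisymm (b' x hx'x).1 (b x' hxx').1)

/-- Such a map induces an injection of the finite set `ZMod N`, hence a surjection, and periodicity
lifts it to the integers. -/
theorem bijective_of_periodic_of_injective {N : ℕ} [NeZero N] {φ : ℤ → ℤ}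
    (hp : ∀ x j : ℤ, φ (x + j * N) = φ x + j * N) (hi : Function.Injective φ) :
    Function.Bijective φ := by
  refine ⟨hi, fun y => ?_⟩
  have hinj : Function.Injective fun a : ZMod N => ((φ a.val : ℤ) : ZMod N) := by
    intro a b h
    obtain ⟨j, hj⟩ := ((ZMod.intCast_eq_intCast_iff _ _ _).1 h).exists_eq_add_mul
    rw [← hp] at hj
    have h2 := congrArg (fun z : ℤ => (z : ZMod N)) (hi hj)
    simpa using h2
  obtain ⟨a, ha⟩ := Finite.surjective_of_injective hinj (y : ZMod N)
  obtain ⟨j, hj⟩ := ((ZMod.intCast_eq_intCast_iff _ _ _).1 ha.symm).exists_eq_add_mul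
  exact ⟨a.val + j * N, by rw [hp, ← hj]⟩

theorem totalShift_eq_zero_of_one_sub {N : ℕ} {w : Equiv.Perm ℤ} (hw : IsPeriodic N w)
    (h : ∀ x, w (1 - x) = 1 - w x) : totalShift N w = 0 := by
  have e : totalShift N w = - totalShift N w := by
    conv_lhs => unfold totalShift
    unfold totalShift
    rw [← mul_neg, ← Finset.sum_neg_distrib]
    congr 1
    refine Finset.sum_bij' (fun x _ => N + 1 - x) (fun x _ => N + 1 - x) ?_ ?_ ?_ ?_ ?_
    · intro x hx
      simp only [Finset.mem_Icc] at hx ⊢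
      omega
    · intro x hx
      simp only [Finset.mem_Icc] at hx ⊢
      omega
    · intro x _
      ring
    · intro x _
      ring
    · intro x _
      rw [show (N : ℤ) + 1 - x = 1 - x + N by ring, hw, h]
      push_cast
      ring
  linarith

/-- The twisted indicator function of a class which does not meet its translates. -/
theorem exists_twisted_indicator {N : ℕ} {R : ℤ → ℤ → Prop} (hR : Equivalence R)
    (hadd : ∀ {x y : ℤ} (j : ℤ), R x y → R (x + j * N) (y + j * N)) {d : ℤ}
    (hd : ∀ j : ℤ, R d (d + j * N) → j = 0) :
    ∃ f : Twisted N, (∀ x y, R x y → f.1 x = f.1 y) ∧ f.1 d = 1 ∧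
      ∀ x, f.1 x ≠ 0 → ∃ j : ℤ, R x (d + j * N) := by
  classical
  have huniq : ∀ {x i j : ℤ}, R x (d + i * N) → R x (d + j * N) → i = j := by
    intro x i j hi hj
    have h := hadd (-i) (hR.trans (hR.symm hi) hj)
    rw [show d + i * (N : ℤ) + -i * N = d by ring,
      show d + j * (N : ℤ) + -i * N = d + (j - i) * N by ring] at h
    have := hd _ h
    omega
  let φ : ℤ → ℚ := fun x => if h : ∃ j : ℤ, R x (d + j * N) then 2 ^ h.choose else 0
  have hφ : ∀ {x j : ℤ}, R x (d + j * N) → φ x = 2 ^ j := by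
    intro x j hj
    have h : ∃ j : ℤ, R x (d + j * N) := ⟨j, hj⟩
    simp only [φ, dif_pos h]
    rw [huniq h.choose_spec hj]
  have hφ0 : ∀ {x : ℤ}, (¬ ∃ j : ℤ, R x (d + j * N)) → φ x = 0 := by
    intro x h
    simp only [φ, dif_neg h]
  refine ⟨⟨φ, fun x => ?_⟩, fun x y hxy => ?_, ?_, fun x hx => ?_⟩
  · by_cases h : ∃ j : ℤ, R x (d + j * N)
    · obtain ⟨j, hj⟩ := h
      have h2 := hadd 1 hj
      rw [one_mul, show d + j * (N : ℤ) + N = d + (j + 1) * N by ring] at h2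
      rw [hφ hj, hφ h2, zpow_add₀ (by norm_num : (2 : ℚ) ≠ 0)]
      ring
    · rw [hφ0 h, hφ0, mul_zero]
      rintro ⟨j, hj⟩
      have h2 := hadd (-1) hj
      rw [show x + (N : ℤ) + -1 * N = x by ring,
        show d + j * (N : ℤ) + -1 * N = d + (j - 1) * N by ring] at h2
      exact h ⟨_, h2⟩
  · change φ x = φ y
    by_cases h : ∃ j : ℤ, R x (d + j * N)
    · obtain ⟨j, hj⟩ := h
      rw [hφ hj, hφ (hR.trans (hR.symm hxy) hj)]
    · rw [hφ0 h, hφ0]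
      rintro ⟨j, hj⟩
      exact h ⟨j, hR.trans hxy hj⟩
  · change φ d = 1
    rw [hφ (j := 0) (by simpa using hR.refl d), zpow_zero]
  · by_contra h
    exact hx (hφ0 h)

theorem IsNext.le_of_isDescent {R : ℤ → ℤ → Prop} {n : ℕ} {w : WA (2 * n)}
    (hw : ∀ x, IsNext R x (w.1 x)) {d : ℤ}
    (hd : IsDescent w.1 d) (y : ℤ) (hy : R d y) : stripKey y ≤ stripKey d := by
  rcases (hw d).2 with ⟨a, -⟩ | ⟨-, b⟩
  · exact absurd a (not_lt.2 hd)
  · exact (b y hy).1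

theorem IsNoncrossing.isNext_add_mul {n : ℕ} {R : ℤ → ℤ → Prop} (hR : IsNoncrossing n R)
    {x y : ℤ} (h : IsNext R x y) (j : ℤ) :
    IsNext R (x + j * ((2 * n : ℕ) : ℤ)) (y + j * ((2 * n : ℕ) : ℤ)) := by
  have key : ∀ z, R (x + j * ((2 * n : ℕ) : ℤ)) z → ∃ z', R x z' ∧
      z = z' + j * ((2 * n : ℕ) : ℤ) := fun z hz => by
    have := hR.add_mul (-j) hz
    refine ⟨z + -j * ((2 * n : ℕ) : ℤ), ?_, by ring⟩
    convert this using 1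
    ring
  obtain ⟨r, ⟨a, b⟩ | ⟨a, b⟩⟩ := h
  · refine ⟨hR.add_mul j r, Or.inl ⟨(stripKey_add_mul_lt n _ _ _).2 a, fun z hz hxz => ?_⟩⟩
    obtain ⟨z', hz', rfl⟩ := key z hz
    exact (stripKey_add_mul_le n _ _ _).2 (b z' hz' ((stripKey_add_mul_lt n _ _ _).1 hxz))
  · refine ⟨hR.add_mul j r, Or.inr ⟨(stripKey_add_mul_le n _ _ _).2 a, fun z hz => ?_⟩⟩
    obtain ⟨z', hz', rfl⟩ := key z hz
    exact ⟨(stripKey_add_mul_le n _ _ _).2 (b z' hz').1,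
      (stripKey_add_mul_le n _ _ _).2 (b z' hz').2⟩

/-- The map `x ↦ 1 - x` exchanges the two halves of the strip order and is increasing on each, so it
preserves the cyclic order although not the linear one. -/
theorem IsNoncrossing.isNext_one_sub {n : ℕ} {R : ℤ → ℤ → Prop} (hR : IsNoncrossing n R)
    {x y : ℤ} (h : IsNext R x y) : IsNext R (1 - x) (1 - y) := by
  have key : ∀ z, R (1 - x) z → R x (1 - z) := fun z hz => by
    have := hR.one_sub hz
    rwa [sub_sub_cancel] at this
  obtain ⟨r, h⟩ := h
  have hx := hR.equivalence.refl x
  refine ⟨hR.one_sub r, ?_⟩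
  simp only [stripKey_lt_iff, stripKey_le_iff] at h ⊢
  by_cases hxy : (1 - x) % 2 = 1 ∧ (1 - y) % 2 = 1 ∧ 1 - x < 1 - y ∨
      (1 - x) % 2 = 1 ∧ (1 - y) % 2 = 0 ∨ (1 - x) % 2 = 0 ∧ (1 - y) % 2 = 0 ∧ 1 - y < 1 - x
  · refine Or.inl ⟨hxy, fun z hz hxz => ?_⟩
    have hz' := key z hz
    rcases h with ⟨a, b⟩ | ⟨a, b⟩
    · have := b _ hz'
      omega
    · have := b _ hz'
      have := b _ hx
      omega
  · refine Or.inr ⟨by omega, fun z hz => ?_⟩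
    have hz' := key z hz
    rcases h with ⟨a, b⟩ | ⟨a, b⟩
    · have := b _ hz'
      omega
    · have := b _ hz'
      have := b _ r
      omega

/-- The point `g` lies between neighbours of one class, hence in another class, which cannot leave
the gap without crossing the first. -/
theorem IsNoncrossing.gap {n : ℕ} {R : ℤ → ℤ → Prop} (hR : IsNoncrossing n R) {x y g h : ℤ}
    (hxy : IsNext R x y) (hgh : R g h) (h1 : stripKey x < stripKey g)
    (h2 : stripKey g < stripKey y) : stripKey x < stripKey h ∧ stripKey h < stripKey y := by
  have hE := hR.equivalence
  have hg : ¬ R x g := fun hxg => by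
    rcases hxy.2 with ⟨-, b⟩ | ⟨a, -⟩
    · exact absurd h2 (not_lt.2 (b g hxg h1))
    · exact absurd (h1.trans h2) (not_lt.2 a)
  constructor
  · by_contra hc
    rcases lt_or_eq_of_le (not_lt.1 hc) with hlt | heq
    · exact hg (hE.trans (hE.symm (hR.noncrossing hlt h1 h2 (hE.symm hgh) hxy.1)) (hE.symm hgh))
    · rw [stripKey_injective heq] at hgh
      exact hg (hE.symm hgh)
  · by_contra hc
    rcases lt_or_eq_of_le (not_lt.1 hc) with hlt | heq
    · exact hg (hR.noncrossing h1 h2 hlt hxy.1 hgh)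
    · rw [← stripKey_injective heq] at hgh
      exact hg (hE.trans hxy.1 (hE.symm hgh))

/-! ### From a symmetric non-crossing partition to a dual element -/

section Construction

variable {n : ℕ} [NeZero (2 * n)]

/-- Translates by `j` and by `-j` both lie in the class, and for `j ≠ 0` one of them is above `d`.
-/
theorem not_rel_translate_of_max {R : ℤ → ℤ → Prop} (hR : Equivalence R)
    (hadd : ∀ {x y : ℤ} (j : ℤ), R x y →
      R (x + j * ((2 * n : ℕ) : ℤ)) (y + j * ((2 * n : ℕ) : ℤ))) {d : ℤ}
    (hd : ∀ y, R d y → stripKey y ≤ stripKey d) (j : ℤ) (h : R d (d + j * ((2 * n : ℕ) : ℤ))) :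
    j = 0 := by
  have h' := hadd (-j) (hR.symm h)
  rw [show d + j * ((2 * n : ℕ) : ℤ) + -j * ((2 * n : ℕ) : ℤ) = d by ring] at h'
  have h1 := stripKey_le_iff.1 (hd _ h)
  have h2 := stripKey_le_iff.1 (hd _ h')
  have h3 := add_mul_emod_two n d j
  have h4 := add_mul_emod_two n d (-j)
  rw [neg_mul] at h2 h4
  have hN : ((2 * n : ℕ) : ℤ) ≠ 0 := Int.natCast_ne_zero.2 (NeZero.ne _)
  have h5 : j * ((2 * n : ℕ) : ℤ) = 0 := by omega
  exact (mul_eq_zero.1 h5).resolve_right hN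

/-- If each descent is the greatest element of its class for some periodic partition into
stable subsets, then descents are separated by invariant functions. -/
theorem separatesDescents_of_max {R : ℤ → ℤ → Prop} (hR : Equivalence R)
    (hadd : ∀ {x y : ℤ} (j : ℤ), R x y →
      R (x + j * ((2 * n : ℕ) : ℤ)) (y + j * ((2 * n : ℕ) : ℤ))) {w : WA (2 * n)}
    (hw : ∀ x, R x (w.1 x))
    (hmax : ∀ d, IsDescent w.1 d → ∀ y, R d y → stripKey y ≤ stripKey d) :
    SeparatesDescents w := by
  intro d hd
  obtain ⟨f, h1, h2, h3⟩ := exists_twisted_indicator hR hadd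
    (not_rel_translate_of_max hR hadd (hmax d hd))
  refine ⟨f, mem_invariants.2 fun x => (h1 _ _ (hw x)).symm, h2, fun d' hd' hne => ?_⟩
  by_contra hf
  obtain ⟨j, hj⟩ := h3 d' hf
  have h4 := hmax d' hd' _ hj
  have h5 := hmax _ ((isDescent_add_mul w d j).2 hd) _ (hR.symm hj)
  rw [stripKey_injective (le_antisymm h5 h4)] at hne
  exact hne (Int.add_mul_modEq _ _ _)

namespace IsNoncrossing

theorem exists_isNext {R : ℤ → ℤ → Prop} (hR : IsNoncrossing n R) (x : ℤ) : ∃ y, IsNext R x y := by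
  have hN : (0 : ℤ) < ((2 * n : ℕ) : ℤ) := Int.natCast_pos.2 (NeZero.pos _)
  by_cases hT : ∃ i : ℤ, i ≠ 0 ∧ R x (x + i * ((2 * n : ℕ) : ℤ))
  · obtain ⟨i, hi, hxi⟩ := hT
    have hall : ∀ j : ℤ, R x (x + j * ((2 * n : ℕ) : ℤ)) := fun j => by
      refine hR.translated hxi hi (j := i) ?_ hi
      have := hR.add_mul j hxi
      rwa [add_right_comm] at this
    -- The class contains all translates of `x`; the next one upwards leaves only finitely many
    -- candidates for the successor.
    obtain ⟨y0, hy0, hlt, hle⟩ : ∃ y0, R x y0 ∧ stripKey x < stripKey y0 ∧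
        ∀ y, stripKey x < stripKey y → stripKey y ≤ stripKey y0 →
          y ∈ Set.Icc (x - ((2 * n : ℕ) : ℤ)) (x + ((2 * n : ℕ) : ℤ)) := by
      rcases Int.emod_two_eq_zero_or_one x with h0 | h0
      · refine ⟨_, hall (-1), ?_, fun y h1 h2 => ?_⟩
        · have := add_mul_emod_two n x (-1)
          rw [stripKey_lt_iff]
          omega
        · rw [stripKey_lt_iff] at h1
          rw [stripKey_le_iff] at h2
          rw [Set.mem_Icc]
          omega
      · refine ⟨_, hall 1, ?_, fun y h1 h2 => ?_⟩
        · have := add_mul_emod_two n x 1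
          rw [stripKey_lt_iff]
          omega
        · have := add_mul_emod_two n x 1
          rw [stripKey_lt_iff] at h1
          rw [stripKey_le_iff] at h2
          rw [Set.mem_Icc]
          omega
    have hfin : {y | R x y ∧ stripKey x < stripKey y ∧ stripKey y ≤ stripKey y0}.Finite :=
      (Set.finite_Icc _ _).subset fun y hy => hle y hy.2.1 hy.2.2
    obtain ⟨y, ⟨a, b, c⟩, hmin⟩ := Set.exists_min_image _ stripKey hfin ⟨y0, hy0, hlt, le_rfl⟩
    refine ⟨y, a, Or.inl ⟨b, fun z hz hxz => ?_⟩⟩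
    rcases le_or_gt (stripKey z) (stripKey y0) with h | h
    · exact hmin z ⟨hz, hxz, h⟩
    · exact c.trans h.le
  · have hfin : {y | R x y}.Finite := by
      refine Set.Finite.of_finite_image (f := fun y => y % ((2 * n : ℕ) : ℤ))
        ((Set.finite_Icc 0 ((2 * n : ℕ) : ℤ)).subset ?_) ?_
      · rintro _ ⟨y, -, rfl⟩
        exact ⟨Int.emod_nonneg _ hN.ne', (Int.emod_lt_of_pos _ hN).le⟩
      · intro y hy y' hy' h
        obtain ⟨j, hj⟩ := (show y' ≡ y [ZMOD ((2 * n : ℕ) : ℤ)] from h.symm).exists_eq_add_mul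
        have hy : R x y := hy
        have hy' : R x y' := hy'
        by_cases h0 : j = 0
        · simp [hj, h0]
        · refine absurd ⟨j, h0, ?_⟩ hT
          rw [hj] at hy'
          exact hR.equivalence.trans hy' (hR.equivalence.symm (hR.add_mul j hy))
    by_cases hne : ∃ y, R x y ∧ stripKey x < stripKey y
    · obtain ⟨y, ⟨a, b⟩, hmin⟩ := Set.exists_min_image
        {y | R x y ∧ stripKey x < stripKey y} stripKey (hfin.subset fun y hy => hy.1) hne
      exact ⟨y, a, Or.inl ⟨b, fun z hz hxz => hmin z ⟨hz, hxz⟩⟩⟩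
    · push Not at hne
      obtain ⟨y, a, hmin⟩ := Set.exists_min_image {y | R x y} stripKey hfin
        ⟨x, hR.equivalence.refl x⟩
      exact ⟨y, a, Or.inr ⟨hne y a, fun z hz => ⟨hne z hz, hmin z hz⟩⟩⟩

theorem exists_perm {R : ℤ → ℤ → Prop} (hR : IsNoncrossing n R) :
    ∃ w : WA (2 * n), sigmaW (2 * n) w = w ∧ ∀ x, IsNext R x (w.1 x) := by
  choose φ hφ using hR.exists_isNext
  have hp : ∀ x j : ℤ, φ (x + j * ((2 * n : ℕ) : ℤ)) = φ x + j * ((2 * n : ℕ) : ℤ) := fun x j =>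
    (hφ _).right_unique (hR.isNext_add_mul (hφ x) j)
  have hb := bijective_of_periodic_of_injective hp fun x y h => by
    have := hφ y
    rw [← h] at this
    exact (hφ x).left_unique hR.equivalence this
  have hs : ∀ x, φ (1 - x) = 1 - φ x := fun x => (hφ _).right_unique (hR.isNext_one_sub (hφ x))
  have hper : IsPeriodic (2 * n) (Equiv.ofBijective φ hb) := fun x => by
    have := hp x 1
    rwa [one_mul] at this
  refine ⟨⟨Equiv.ofBijective φ hb, hper, totalShift_eq_zero_of_one_sub hper hs⟩, ?_, hφ⟩
  apply Subtype.ext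
  ext x
  change 1 - φ (1 - x) = φ x
  rw [hs]
  ring

theorem isDual {R : ℤ → ℤ → Prop} (hR : IsNoncrossing n R) {w : WA (2 * n)}
    (hw : ∀ x, IsNext R x (w.1 x)) : IsDual w := by
  rw [isDual_iff]
  refine ⟨separatesDescents_of_max hR.equivalence hR.add_mul (fun x => (hw x).1)
    fun d hd => IsNext.le_of_isDescent hw hd, ?_⟩
  set b := w⁻¹ * coxeterC n with hb
  have hwb : ∀ x, w.1 (b.1 x) = cPerm x := fun x => by
    change w.1 (w.1.symm (cPerm x)) = _
    simp
  refine separatesDescents_of_max (R := b.1.SameCycle)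
    (Equiv.Perm.SameCycle.equivalence b.1) ?_ (fun x => ⟨1, by simp⟩) ?_
  · rintro x y j ⟨i, hi⟩
    have hp : IsPeriodic (2 * n) (b.1 ^ i) := ((WA (2 * n)).zpow_mem b.2 i).1
    exact ⟨i, by rw [hp.add_mul, hi]⟩
  · intro z hz
    have hxz : w.1 (b.1 z) = cPerm z := hwb z
    set x := b.1 z with hx
    have hnext := hw x
    have hlt : stripKey x < stripKey (w.1 x) := by
      rw [hxz, stripKey_lt_cPerm_iff_le]
      exact hz
    -- For a descent `z` of `b`, the interval from `x = b z` to `z` is stable by `b`: the points `b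
    -- y` and `w (b y) = c y` are in the same class, which stays in the gap between `x` and `w x = c
    -- z`. So `z` is the greatest point of its cycle.
    let P : ℤ → Prop := fun y => stripKey x ≤ stripKey y ∧ stripKey y ≤ stripKey z
    have hstep : ∀ y, P y ↔ P (b.1 y) := by
      intro y
      have e1 : stripKey x ≤ stripKey y ↔ stripKey x < stripKey (w.1 (b.1 y)) := by
        rw [hwb, stripKey_lt_cPerm_iff_le]
      have e2 : stripKey y ≤ stripKey z ↔ stripKey (w.1 (b.1 y)) ≤ stripKey (w.1 x) := by
        rw [hwb, hxz, ← stripKey_lt_iff_cPerm_le, stripKey_lt_cPerm_iff_le]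
      have e3 : stripKey (b.1 y) ≤ stripKey z ↔ stripKey (b.1 y) < stripKey (w.1 x) := by
        rw [hxz, stripKey_lt_cPerm_iff_le]
      change (_ ∧ _) ↔ (_ ∧ _)
      rw [e1, e2, e3]
      have hR' := (hw (b.1 y)).1
      constructor
      · rintro ⟨h1, h2⟩
        rcases lt_or_eq_of_le h2 with h2 | h2
        · have := hR.gap hnext (hR.equivalence.symm hR') h1 h2
          exact ⟨this.1.le, this.2⟩
        · rw [w.1.injective (stripKey_injective h2)]
          exact ⟨le_rfl, hlt⟩
      · rintro ⟨h1, h2⟩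
        rcases lt_or_eq_of_le h1 with h1 | h1
        · have := hR.gap hnext hR' h1 h2
          exact ⟨this.1, this.2.le⟩
        · rw [← stripKey_injective h1]
          exact ⟨hlt, le_rfl⟩
    have hz0 : P z := ⟨hz, le_rfl⟩
    rintro _ ⟨i, rfl⟩
    suffices h : P ((b.1 ^ i) z) from h.2
    induction i using Int.induction_on with
    | zero => simpa using hz0
    | succ k ih =>
      rw [add_comm, zpow_add, zpow_one, Equiv.Perm.mul_apply]
      exact (hstep _).1 ih
    | pred k ih =>
      rw [hstep, ← Equiv.Perm.mul_apply, ← zpow_one_add]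
      convert ih using 4
      ring

/-- Descents are greatest elements of their classes, so two orbits of one class that both have a
descent share it. If the function vanishes at one point of a class, it vanishes on the whole class.
-/
theorem invariants_apply_eq {R : ℤ → ℤ → Prop} (hR : IsNoncrossing n R) {w : WA (2 * n)}
    (hw : ∀ x, IsNext R x (w.1 x)) {f : Twisted (2 * n)}
    (hf : f ∈ invariants w) {x y : ℤ} (hxy : R x y) : f.1 x = f.1 y := by
  have hE := hR.equivalence
  have hpow : ∀ (x : ℤ) (i : ℕ), R x ((w.1 ^ i) x) := fun x i => by
    induction i with
    | zero => simpa using hE.refl x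
    | succ i ih =>
      rw [pow_succ', Equiv.Perm.mul_apply]
      exact hE.trans ih (hw _).1
  have key : ∀ x, f.1 x = 0 ∨ ∃ m : ℕ, IsDescent w.1 ((w.1 ^ m) x) := fun x => by
    by_cases h : f.1 x = 0
    · exact Or.inl h
    · exact Or.inr (exists_isDescent_of_ne_zero hf h)
  have key2 : ∀ x y, R x y → f.1 x = 0 → f.1 y = 0 := by
    intro x y hxy hx
    rcases key y with h | ⟨m, hm⟩
    · exact h
    have hmax := IsNext.le_of_isDescent hw hm
    obtain ⟨i, hi, s, hs⟩ := exists_pow_eq_add_mul w x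
    have hs0 : s = 0 := by
      refine not_rel_translate_of_max hE hR.add_mul hmax s ?_
      have h1 := hpow x i
      rw [hs] at h1
      have h2 : R ((w.1 ^ m) y) x := hE.symm (hE.trans hxy (hpow y m))
      exact hE.trans h2 (hE.trans h1 (hR.add_mul s (hE.symm h2)))
    rw [hs0, zero_mul, add_zero] at hs
    obtain ⟨m', hm'⟩ := exists_isDescent_of_pow_eq hi hs
    have hRd : R ((w.1 ^ m') x) ((w.1 ^ m) y) :=
      hE.trans (hE.symm (hpow x m')) (hE.trans hxy (hpow y m))
    have he := stripKey_injective (le_antisymm (IsNext.le_of_isDescent hw hm' _ hRd)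
      (hmax _ (hE.symm hRd)))
    rw [← invariants_pow hf m, he, invariants_pow hf, hx]
  rcases key x with hx | ⟨m, hm⟩
  · rw [hx, key2 x y hxy hx]
  rcases key y with hy | ⟨m', hm'⟩
  · rw [hy, key2 y x (hE.symm hxy) hy]
  have hRd : R ((w.1 ^ m) x) ((w.1 ^ m') y) :=
    hE.trans (hE.symm (hpow x m)) (hE.trans hxy (hpow y m'))
  have he := stripKey_injective (le_antisymm (IsNext.le_of_isDescent hw hm _ hRd)
    (IsNext.le_of_isDescent hw hm' _ (hE.symm hRd)))
  rw [← invariants_pow hf m, ← he, invariants_pow hf]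

end IsNoncrossing

end Construction

/-! ## Divisibility of dual elements fixed by the involution -/

/-- The bilinear form `∑ f(x) g(1 - x)` on twisted functions. -/
noncomputable def twistedForm (N : ℕ) : LinearMap.BilinForm ℚ (Twisted N) :=
  LinearMap.mk₂ ℚ (fun f g => ∑ x ∈ Finset.Icc (1 : ℤ) N, f.1 x * g.1 (1 - x))
    (fun f f' g => by simp [add_mul, Finset.sum_add_distrib])
    (fun a f g => by simp [Finset.mul_sum, mul_assoc])
    (fun f g g' => by simp [mul_add, Finset.sum_add_distrib])
    (fun a f g => by simp [Finset.mul_sum, mul_left_comm])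

theorem twistedForm_apply {N : ℕ} (f g : Twisted N) :
    twistedForm N f g = ∑ x ∈ Finset.Icc (1 : ℤ) N, f.1 x * g.1 (1 - x) := rfl

theorem twistedForm_comm {N : ℕ} (f g : Twisted N) : twistedForm N f g = twistedForm N g f := by
  rw [twistedForm_apply, twistedForm_apply]
  refine Finset.sum_bij' (fun x _ => N + 1 - x) (fun x _ => N + 1 - x) ?_ ?_ ?_ ?_ ?_
  · intro x hx
    simp only [Finset.mem_Icc] at hx ⊢
    omega
  · intro x hx
    simp only [Finset.mem_Icc] at hx ⊢
    omega
  · intro x _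
    ring
  · intro x _
    ring
  · intro x _
    have h1 := f.2 (x - N)
    have h2 := g.2 (1 - x)
    rw [sub_add_cancel] at h1
    rw [h1, show (N : ℤ) + 1 - x = 1 - x + N by ring, h2,
      show 1 - (1 - x + (N : ℤ)) = x - N by ring]
    ring

theorem twistedForm_nondegenerate (N : ℕ) [NeZero N] : (twistedForm N).Nondegenerate := by
  have hl : ∀ f : Twisted N, (∀ g, twistedForm N f g = 0) → f = 0 := by
    intro f hf
    apply Subtype.ext
    funext a
    obtain ⟨j, hj⟩ := exists_add_mul_mem_Icc N a
    have h := hf (twistedSingle N (1 - (a + j * N)))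
    rw [twistedForm_apply, Finset.sum_eq_single_of_mem _ hj] at h
    · rw [twistedSingle_self, mul_one, twisted_apply_add_mul] at h
      exact (mul_eq_zero.1 h).resolve_left (zpow_ne_zero _ (by norm_num))
    · intro x hx hne
      rw [twistedSingle_of_not_modEq, mul_zero]
      intro hm
      have hm' : x - 1 ≡ a + j * N - 1 [ZMOD N] := by
        have := hm.neg
        rwa [neg_sub, neg_sub] at this
      have a1 := Finset.mem_Icc.1 hx
      have a2 := Finset.mem_Icc.1 hj
      unfold Int.ModEq at hm'
      rw [Int.emod_eq_of_lt (by omega) (by omega), Int.emod_eq_of_lt (by omega) (by omega)] at hm'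
      omega
  exact ⟨hl, fun g hg => hl g fun f => by rw [twistedForm_comm, hg]⟩

/-- The powers of 2 in `f(x)` and `g(1 - x)` cancel under translation, so the sum over a period may
be reindexed by `w`, which commutes with `x ↦ 1 - x`. -/
theorem twistedForm_pullback {N : ℕ} {w : WA N} (hw : sigmaW N w = w) (f g : Twisted N) :
    twistedForm N (pullback w f) (pullback w g) = twistedForm N f g := by
  rw [twistedForm_apply, twistedForm_apply]
  rw [← sum_period w.2.1 (fun x => f.1 x * g.1 (1 - x))]
  · refine Finset.sum_congr rfl fun x _ => ?_
    change f.1 (w.1 x) * g.1 (w.1 (1 - x)) = _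
    rw [apply_one_sub hw]
  · intro i k
    rw [show 1 - (i + k * (N : ℤ)) = 1 - i + (-k) * N by ring, twisted_apply_add_mul,
      twisted_apply_add_mul, zpow_neg]
    have : (2 : ℚ) ^ k ≠ 0 := zpow_ne_zero _ (by norm_num)
    field_simp

theorem invDim_add_finrank_range {N : ℕ} [NeZero N] (w : WA N) :
    finrank ℚ (LinearMap.range (pullback w - 1)) + invDim w = N := by
  have h := (pullback w - 1).finrank_range_add_finrank_ker
  rw [finrank_twisted] at h
  exact h

theorem range_pullback_sub_one {N : ℕ} [NeZero N] {w : WA N} (hw : sigmaW N w = w) :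
    LinearMap.range (pullback w - 1) = (twistedForm N).orthogonal (invariants w) := by
  refine Submodule.eq_of_le_of_finrank_eq ?_ ?_
  · rintro _ ⟨f, rfl⟩ g hg
    have hg' : pullback w g = g := sub_eq_zero.1 hg
    change twistedForm N g (pullback w f - f) = 0
    rw [map_sub, sub_eq_zero]
    conv_lhs => rw [← hg']
    exact twistedForm_pullback hw g f
  · rw [LinearMap.BilinForm.finrank_orthogonal (twistedForm_nondegenerate N),
      finrank_twisted]
    have := invDim_add_finrank_range w
    unfold invDim at this
    omega

/-- If `f` is invariant by `w⁻¹ c`, then `f ∘ c⁻¹ = f ∘ w⁻¹`, so `f ∘ c⁻¹ - f` is the image of `-f ∘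
w⁻¹` by `pullback w - 1`. -/
theorem invariants_complement_map_le {n : ℕ} (w : WA (2 * n)) :
    (invariants (w⁻¹ * coxeterC n)).map (pullback (coxeterC n)⁻¹ - 1) ≤
      LinearMap.range (pullback w - 1) := by
  rintro _ ⟨f, hf, rfl⟩
  have hf := mem_invariants.1 hf
  refine ⟨-pullback w⁻¹ f, ?_⟩
  apply Subtype.ext
  funext x
  have h1 := hf ((coxeterC n).1.symm x)
  have h1 : f.1 (w.1.symm ((coxeterC n).1 ((coxeterC n).1.symm x))) =
    f.1 ((coxeterC n).1.symm x) := h1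
  rw [Equiv.apply_symm_apply] at h1
  change -f.1 (w.1.symm (w.1 x)) - -f.1 (w.1.symm x) = f.1 ((coxeterC n).1.symm x) - f.1 x
  rw [Equiv.symm_apply_apply, h1]
  ring

/-! ### Divisibility as inclusion of invariants -/

section Divisibility

variable {n : ℕ} [NeZero (2 * n)]

theorem pullback_coxeterC_injective :
    Function.Injective (pullback (coxeterC n)⁻¹ - 1 : Module.End ℚ (Twisted (2 * n))) := by
  intro f g h
  have hfg : f - g ∈ invariants (coxeterC n)⁻¹ := by
    change (pullback (coxeterC n)⁻¹ - 1) (f - g) = 0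
    rw [map_sub, h, sub_self]
  rw [invariants_inv, Submodule.finrank_eq_zero.1 (invDim_coxeterC n)] at hfg
  exact sub_eq_zero.1 hfg

theorem IsDual.invariants_complement_map {w : WA (2 * n)} (hw : IsDual w) :
    (invariants (w⁻¹ * coxeterC n)).map (pullback (coxeterC n)⁻¹ - 1) =
      LinearMap.range (pullback w - 1) := by
  refine Submodule.eq_of_le_of_finrank_eq (invariants_complement_map_le w) ?_
  rw [(Submodule.equivMapOfInjective _ pullback_coxeterC_injective _).symm.finrank_eq]
  have h1 := invDim_add_finrank_range w
  unfold IsDual at hw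
  unfold invDim at *
  omega

/-- The injective operator `pullback c⁻¹ - 1` carries invariants of a complement into the orthogonal
of the invariants of the element, onto it for the dual `v`; taking orthogonals reverses inclusion.
-/
theorem invariants_complement_anti {u v : WA (2 * n)} (hv : IsDual v)
    (hus : sigmaW (2 * n) u = u) (hvs : sigmaW (2 * n) v = v) (h : invariants v ≤ invariants u) :
    invariants (u⁻¹ * coxeterC n) ≤ invariants (v⁻¹ * coxeterC n) := by
  intro f hf
  have h1 : (pullback (coxeterC n)⁻¹ - 1) f ∈
      (invariants (v⁻¹ * coxeterC n)).map (pullback (coxeterC n)⁻¹ - 1) := by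
    rw [hv.invariants_complement_map, range_pullback_sub_one hvs]
    refine LinearMap.BilinForm.orthogonal_le h ?_
    rw [← range_pullback_sub_one hus]
    exact invariants_complement_map_le u ⟨f, hf, rfl⟩
  obtain ⟨g, hg, e⟩ := h1
  rwa [← pullback_coxeterC_injective e]

/-- Divisibility of dual elements fixed by the involution is read off invariant functions. -/
theorem invDim_add_of_invariants_le {u v : WA (2 * n)} (hu : IsDual u) (hv : IsDual v)
    (hus : sigmaW (2 * n) u = u) (hvs : sigmaW (2 * n) v = v) (h : invariants v ≤ invariants u) :
    invDim u + invDim (u⁻¹ * v) = 2 * n + invDim v := by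
  have hc := invariants_complement_anti hv hus hvs h
  have h1 : invariants v ≤ invariants (u⁻¹ * v) := fun f hf =>
    inf_invariants_le u⁻¹ v ⟨by rw [invariants_inv]; exact h hf, hf⟩
  have h2 : invariants (u⁻¹ * coxeterC n) ≤ invariants (u⁻¹ * v) := fun f hf => by
    have e : u⁻¹ * v = (u⁻¹ * coxeterC n) * (v⁻¹ * coxeterC n)⁻¹ := by group
    rw [e]
    exact inf_invariants_le _ _ ⟨hf, by rw [invariants_inv]; exact hc hf⟩
  have h3 : invariants v ⊓ invariants (u⁻¹ * coxeterC n) = ⊥ := by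
    rw [eq_bot_iff]
    have h4 : invariants (coxeterC n) = ⊥ := Submodule.finrank_eq_zero.1 (invDim_coxeterC n)
    rintro f ⟨hf, hf'⟩
    have := inf_invariants_le v (v⁻¹ * coxeterC n) ⟨hf, hc hf'⟩
    rwa [mul_inv_cancel_left, h4] at this
  -- The invariants of `v` and of `u⁻¹ c` are independent subspaces of those of `u⁻¹ v`. Their
  -- dimensions give the lower bound, and subadditivity for `v = u (u⁻¹ v)` gives the upper one.
  have h5 := Submodule.finrank_sup_add_finrank_inf_eq (invariants v) (invariants (u⁻¹ * coxeterC n))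
  rw [h3, finrank_bot] at h5
  have h6 := Submodule.finrank_mono (sup_le h1 h2)
  have h7 := invDim_mul u (u⁻¹ * v)
  rw [mul_inv_cancel_left] at h7
  unfold IsDual at hu
  unfold invDim at *
  omega

theorem invariants_le_of_invDim_add {u v : WA (2 * n)}
    (h : invDim u + invDim v = 2 * n + invDim (u * v)) : invariants (u * v) ≤ invariants u := by
  have h1 := finrank_inf_ge (invariants u) (invariants v)
  have h2 : invariants u ⊓ invariants v = invariants (u * v) :=
    Submodule.eq_of_le_of_finrank_le (inf_invariants_le u v) (by unfold invDim at h; omega)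
  rw [← h2]
  exact inf_le_left

end Divisibility

/-- Least upper bounds of dual elements fixed by the involution: the classes of `m` are the
intersections of the classes of the upper bounds of `u` and `v`. -/
theorem exists_isDual_lub {n : ℕ} [NeZero (2 * n)] (u v : WA (2 * n)) :
    ∃ m : WA (2 * n), IsDual m ∧ sigmaW (2 * n) m = m ∧ invariants m ≤ invariants u ∧
      invariants m ≤ invariants v ∧ ∀ q : WA (2 * n), IsDual q → sigmaW (2 * n) q = q →
        invariants q ≤ invariants u → invariants q ≤ invariants v →
          invariants q ≤ invariants m := by
  let U : Set (WA (2 * n)) := {q | IsDual q ∧ sigmaW (2 * n) q = q ∧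
    invariants q ≤ invariants u ∧ invariants q ≤ invariants v}
  -- Each condition on admissible partitions survives arbitrary intersections, including the one
  -- that merges all translated classes.
  let R : ℤ → ℤ → Prop := fun x y => ∀ q ∈ U, Agree q x y
  have hq : ∀ q ∈ U, IsNoncrossing n (Agree q) := fun q hq => hq.1.isNoncrossing_agree hq.2.1
  have hR : IsNoncrossing n R :=
    { equivalence := ⟨fun x q h => (hq q h).equivalence.refl x, fun h q hU => (h q hU).symm,
        fun h h' q hU => (h q hU).trans (h' q hU)⟩
      add_mul := fun j h q hU => (hq q hU).add_mul j (h q hU)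
      one_sub := fun h q hU => (hq q hU).one_sub (h q hU)
      noncrossing := fun h1 h2 h3 h h' q hU => (hq q hU).noncrossing h1 h2 h3 (h q hU) (h' q hU)
      translated := fun h hi h' hj q hU => (hq q hU).translated (h q hU) hi (h' q hU) hj }
  obtain ⟨m, hms, hm⟩ := hR.exists_perm
  have key : ∀ u : WA (2 * n), (∀ q ∈ U, invariants q ≤ invariants u) →
      invariants m ≤ invariants u := fun u h f hf => by
    refine mem_invariants.2 fun x => (hR.invariants_apply_eq hm hf ?_).symm
    exact fun q hU => invariants_le_iff_agree.1 (h q hU) _ _ (Agree.apply u x)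
  refine ⟨m, hR.isDual hm, hms, key u fun q h => h.2.2.1, key v fun q h => h.2.2.2,
    fun q h1 h2 h3 h4 f hf => mem_invariants.2 fun x => ?_⟩
  exact ((hm x).1 q ⟨h1, h2, h3, h4⟩ f hf).symm

/-! ## The germ of fixed points -/

/-- The type underlying the germ `P^σ`. -/
abbrev FixedDual (n : ℕ) : Type := {p : {w : WA (2 * n) //
  LenDvd (reflections (2 * n)) w (coxeterC n)} // (sigma n).toEquiv p = p}

theorem FixedDual.sigmaW_eq {n : ℕ} (p : FixedDual n) : sigmaW (2 * n) p.1.1 = p.1.1 :=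
  congrArg Subtype.val p.2

theorem FixedDual.ext {n : ℕ} {p q : FixedDual n} (h : p.1.1 = q.1.1) : p = q :=
  Subtype.ext (Subtype.ext h)

/-- The canonical morphism from the monoid of the germ to the Coxeter group. -/
noncomputable def germMonoidHom (n : ℕ) : (Germ.fixed (sigma n)).GermMonoid →* WA (2 * n) :=
  PresentedMonoid.lift (fun p => p.1.1) (by
    rintro _ _ (_ | h)
    · rfl
    · simp only [map_mul, FreeMonoid.lift_eval_of]
      obtain ⟨h1, rfl⟩ := h
      rfl)

section Germ

variable {n : ℕ} [NeZero (2 * n)]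

theorem FixedDual.isDual (p : FixedDual n) : IsDual p.1.1 := lenDvd_coxeterC_iff.1 p.1.2

/-- A dual element fixed by the involution, as an element of the germ. -/
def FixedDual.mk {w : WA (2 * n)} (hw : IsDual w) (hs : sigmaW (2 * n) w = w) : FixedDual n :=
  ⟨⟨w, lenDvd_coxeterC_iff.2 hw⟩, Subtype.ext hs⟩

/-- On dual elements length is codimension, so additivity of lengths is this identity between
dimensions. -/
theorem mem_fixed_mul_iff {p q r : FixedDual n} : r ∈ (Germ.fixed (sigma n)).mul p q ↔
    r.1.1 = p.1.1 * q.1.1 ∧ invDim p.1.1 + invDim q.1.1 = 2 * n + invDim r.1.1 := by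
  have hp := (FixedDual.isDual p).wordLength_add
  have hq := (FixedDual.isDual q).wordLength_add
  have hr := (FixedDual.isDual r).wordLength_add
  constructor
  · rintro ⟨⟨h1, h2⟩, h⟩
    have e : r.1.1 = p.1.1 * q.1.1 := (congrArg (fun s => s.1.1) h).symm
    rw [← e] at h2
    exact ⟨e, by omega⟩
  · rintro ⟨e, h⟩
    refine ⟨⟨e ▸ r.1.2, ?_⟩, FixedDual.ext e.symm⟩
    rw [← e]
    omega

theorem leftDvd_fixed_iff {p q : FixedDual n} :
    (Germ.fixed (sigma n)).LeftDvd p q ↔ invariants q.1.1 ≤ invariants p.1.1 := by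
  constructor
  · rintro ⟨r, hr⟩
    obtain ⟨e, h⟩ := mem_fixed_mul_iff.1 hr
    rw [e] at h ⊢
    exact invariants_le_of_invDim_add h
  · intro h
    have h1 := invDim_add_of_invariants_le (FixedDual.isDual p) (FixedDual.isDual q)
      (FixedDual.sigmaW_eq p) (FixedDual.sigmaW_eq q) h
    have e : p.1.1 * (p.1.1⁻¹ * q.1.1) = q.1.1 := mul_inv_cancel_left _ _
    have hd := (isDual_of_mul (u := p.1.1) (v := p.1.1⁻¹ * q.1.1)
      (by rw [e]; exact FixedDual.isDual q)
      (by rw [e]; exact h1)).2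
    have hs : sigmaW (2 * n) (p.1.1⁻¹ * q.1.1) = p.1.1⁻¹ * q.1.1 := by
      rw [map_mul, map_inv, FixedDual.sigmaW_eq p, FixedDual.sigmaW_eq q]
    exact ⟨FixedDual.mk hd hs, mem_fixed_mul_iff.2 ⟨e.symm, h1⟩⟩

/-- Additivity of codimension for a triple product forces it for each partial product, and
`isDual_of_mul` then puts these products in the germ. -/
theorem fixed_isAssociative : (Germ.fixed (sigma n)).IsAssociative := by
  intro a b c
  have hs : ∀ a b : FixedDual n, sigmaW (2 * n) (a.1.1 * b.1.1) = a.1.1 * b.1.1 := fun a b => by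
    rw [map_mul, FixedDual.sigmaW_eq a, FixedDual.sigmaW_eq b]
  refine Part.ext fun d => ?_
  simp only [Part.mem_bind_iff]
  constructor
  · rintro ⟨x, hx, hd⟩
    obtain ⟨e1, h1⟩ := mem_fixed_mul_iff.1 hx
    obtain ⟨e2, h2⟩ := mem_fixed_mul_iff.1 hd
    have e : d.1.1 = a.1.1 * b.1.1 * c.1.1 := by rw [e2, e1, mul_assoc]
    have k1 := invDim_mul a.1.1 b.1.1
    have k2 := invDim_mul (a.1.1 * b.1.1) c.1.1
    rw [← e] at k2
    have hdual := (isDual_of_mul (u := a.1.1 * b.1.1) (v := c.1.1)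
      (by rw [← e]; exact FixedDual.isDual d)
      (by rw [← e]; omega)).1
    refine ⟨FixedDual.mk hdual (hs a b), mem_fixed_mul_iff.2 ⟨rfl, ?_⟩,
      mem_fixed_mul_iff.2 ⟨e, ?_⟩⟩
    · change _ = _ + invDim (a.1.1 * b.1.1)
      omega
    · change invDim (a.1.1 * b.1.1) + _ = _
      omega
  · rintro ⟨x, hx, hd⟩
    obtain ⟨e1, h1⟩ := mem_fixed_mul_iff.1 hx
    obtain ⟨e2, h2⟩ := mem_fixed_mul_iff.1 hd
    have e : d.1.1 = a.1.1 * (b.1.1 * c.1.1) := by rw [e2, e1, mul_assoc]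
    have k1 := invDim_mul b.1.1 c.1.1
    have k2 := invDim_mul a.1.1 (b.1.1 * c.1.1)
    rw [← e] at k2
    have hdual := (isDual_of_mul (u := a.1.1) (v := b.1.1 * c.1.1)
      (by rw [← e]; exact FixedDual.isDual d)
      (by rw [← e]; omega)).2
    refine ⟨FixedDual.mk hdual (hs b c), mem_fixed_mul_iff.2 ⟨rfl, ?_⟩,
      mem_fixed_mul_iff.2 ⟨e, ?_⟩⟩
    · change _ = _ + invDim (b.1.1 * c.1.1)
      omega
    · change _ + invDim (b.1.1 * c.1.1) = _
      omega

theorem invDim_lt_of_mem_mul {p q r : FixedDual n} (h : r ∈ (Germ.fixed (sigma n)).mul p q) :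
    (p ≠ r → invDim r.1.1 < invDim p.1.1) ∧ (q ≠ r → invDim r.1.1 < invDim q.1.1) := by
  obtain ⟨e, h⟩ := mem_fixed_mul_iff.1 h
  have hp := invDim_le p.1.1
  have hq := invDim_le q.1.1
  constructor
  · intro hne
    have : invDim q.1.1 ≠ 2 * n := fun h' =>
      hne (FixedDual.ext (by rw [e, eq_one_of_invDim_eq h', mul_one]))
    omega
  · intro hne
    have : invDim p.1.1 ≠ 2 * n := fun h' =>
      hne (FixedDual.ext (by rw [e, eq_one_of_invDim_eq h', one_mul]))
    omega

theorem not_exists_invDim_increasing :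
    ¬ ∃ f : ℕ → FixedDual n, ∀ i, invDim (f i).1.1 < invDim (f (i + 1)).1.1 := by
  rintro ⟨f, hf⟩
  have h : ∀ i, i ≤ invDim (f i).1.1 := fun i => by
    induction i with
    | zero => exact Nat.zero_le _
    | succ i ih => exact ih.trans_lt (hf i)
  have h1 := h (2 * n + 1)
  have h2 := invDim_le (f (2 * n + 1)).1.1
  omega

theorem fixed_isNoetherian : (Germ.fixed (sigma n)).IsNoetherian := by
  constructor
  · rintro ⟨f, hf⟩
    refine not_exists_invDim_increasing ⟨f, fun i => ?_⟩
    obtain ⟨⟨c, hc⟩, hne⟩ := hf i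
    exact (invDim_lt_of_mem_mul hc).1 hne
  · rintro ⟨f, hf⟩
    refine not_exists_invDim_increasing ⟨f, fun i => ?_⟩
    obtain ⟨⟨c, hc⟩, hne⟩ := hf i
    exact (invDim_lt_of_mem_mul hc).2 hne

end Germ

theorem mainTheorem3 (n : ℕ) (hn : 1 ≤ n) : (Germ.fixed (sigma n)).IsGarside := by
  have : NeZero (2 * n) := ⟨by omega⟩
  refine ⟨fixed_isAssociative, fixed_isNoetherian, fun a b => ?_, fun m a b h => ?_,
    fun m a b h => ?_, ?_⟩
  · obtain ⟨m, hm, hs, h1, h2, h3⟩ := exists_isDual_lub a.1.1 b.1.1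
    refine ⟨FixedDual.mk hm hs, leftDvd_fixed_iff.2 h1, leftDvd_fixed_iff.2 h2, fun q ha hb => ?_⟩
    exact leftDvd_fixed_iff.2 (h3 _ (FixedDual.isDual q) (FixedDual.sigmaW_eq q)
      (leftDvd_fixed_iff.1 ha)
      (leftDvd_fixed_iff.1 hb))
  -- The equality is cancelled in the group, where the germ embeds.
  · have := congrArg (germMonoidHom n) h
    rw [map_mul, map_mul] at this
    exact FixedDual.ext (mul_right_cancel this)
  · have := congrArg (germMonoidHom n) h
    rw [map_mul, map_mul] at this
    exact FixedDual.ext (mul_left_cancel this)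
  · refine ⟨FixedDual.mk isDual_coxeterC (sigmaW_coxeterC n), fun p => ⟨?_, ?_⟩⟩
    · refine leftDvd_fixed_iff.2 ?_
      change invariants (coxeterC n) ≤ _
      rw [Submodule.finrank_eq_zero.1 (invDim_coxeterC n)]
      exact bot_le
    · have e : coxeterC n = (coxeterC n * p.1.1⁻¹) * p.1.1 := (inv_mul_cancel_right _ _).symm
      -- The left complement `c p⁻¹` is conjugate by `p` to `p⁻¹ c`, so it has the same dimension of
      -- invariants.
      have hk : invDim (coxeterC n * p.1.1⁻¹) + invDim p.1.1 = 2 * n + invDim (coxeterC n) := by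
        have h1 := FixedDual.isDual p
        unfold IsDual at h1
        have h2 := invDim_conj p.1.1 (coxeterC n * p.1.1⁻¹)
        rw [mul_assoc, inv_mul_cancel_right] at h2
        rw [invDim_coxeterC]
        omega
      have hd := (isDual_of_mul (u := coxeterC n * p.1.1⁻¹) (v := p.1.1)
        (by rw [← e]; exact isDual_coxeterC) (by rw [← e]; exact hk)).1
      have hs : sigmaW (2 * n) (coxeterC n * p.1.1⁻¹) = coxeterC n * p.1.1⁻¹ := by
        rw [map_mul, map_inv, sigmaW_coxeterC, FixedDual.sigmaW_eq p]
      exact ⟨FixedDual.mk hd hs, mem_fixed_mul_iff.2 ⟨e, hk⟩⟩
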